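/- Let $1<p<\infty$, $1\le q<\infty$, $p\ne q$. For a measure space $(\Omega,\Sigma,\mu)$ let $L_{p,q}(\Omega)$ be the real Lorentz space of (classes of) measurable functions $f$ with $\|f\|_{p,q}=\bigl(\int_0^\infty f^*(t)^q\,d t^{q/p}\bigr)^{1/q}<\infty$, where $f^*(t)=\inf\{s>0:\mu(\{|f|>s\})\le t\}$. If $\Omega$ is the disjoint union of a sequence of atoms $A_n$, $n\ge 1$, with $0<\mu(A_n)<\infty$, write $\ell_{p,q}(\{A_n\})=L_{p,q}(\Omega)$. This space is said to be of type $\ell_{p,q,0}$ if $\mu(A_n)\to 0$; of type $\ell_{p,q,\infty}$ if $\mu(A_n)\to\infty$; of type $\ell_{p,q,1}$ if $0<\liminf_n\mu(A_n)\le\limsup_n\mu(A_n)<\infty$. It is of type - (iv) if $0=\liminf_n\mu(A_n)<\limsup_n\mu(A_n)<\infty$; - (v) if $0<\liminf_n\mu(A_n)<\limsup_n\mu(A_n)=\infty$; - (vi) if $0=\liminf_n\mu(A_n)<\limsup_n\mu(A_n)=\infty$. Write $X\approx Y$ if there is a bounded linear bijection from $X$ onto $Y$ with bounded inverse. Let $\ell_{p,q}(\{A_n\})$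 be of type (iv), (v) or (vi), and consider the condition (E) there is $a>0$ such that $\sum_{\mu(A_n)<a}\mu(A_n)<\infty$ and, for every $b<\infty$, only finitely many $n$ satisfy $a\le\mu(A_n)<b$. If (E) fails, then there exist a space $X_1$ of type $\ell_{p,q,0}$, a space $X_2$ of type $\ell_{p,q,1}$ and a space $X_3$ of type $\ell_{p,q,\infty}$ such that $$\ell_{p,q}(\{A_n\})\approx X_1\oplus X_2\oplus X_3 .$$ If (E) holds, then $\ell_{p,q}(\{A_n\})$ is of type (vi), and the same holds with the summand $X_2$ absent: there exist $X_1$ of type $\ell_{p,q,0}$ and $X_3$ of type $\ell_{p,q,\infty}$ such that $\ell_{p,q}(\{A_n\})\approx X_1\oplus X_3$. -/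

import Mathlib

open MeasureTheory Filter Topology
open scoped ENNReal NNReal

universe u

noncomputable section

/-! ### Lorentz spaces on a measure space -/

section Lorentz

variable {Ω : Type*} [MeasurableSpace Ω] {μ : Measure Ω}

/-- The distribution function `d_{|f|}(s) = μ {|f| > s}`. -/
def distribution (f : Ω →ₘ[μ] ℝ) (s : ℝ≥0) : ℝ≥0∞ :=
  μ {x | (s : ℝ) < |f x|}

/-- The decreasing rearrangement `f^*(t) = inf {s > 0 : d_{|f|}(s) ≤ t}`; it is `∞` when there is
no such `s`. -/
def rearrangement (f : Ω →ₘ[μ] ℝ) (t : ℝ) : ℝ≥0∞ :=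
  ⨅ (s : ℝ≥0) (_ : 0 < s ∧ distribution f s ≤ ENNReal.ofReal t), (s : ℝ≥0∞)

/-- The Lorentz functional `(∫_0^∞ f^*(t)^q d(t^{q/p}))^{1/q}`, with values in `[0, ∞]`; the
measure `d(t^{q/p})` on `(0, ∞)` has the density `(q/p) t^{q/p-1}`. -/
def lorentzENorm (p q : ℝ) (f : Ω →ₘ[μ] ℝ) : ℝ≥0∞ :=
  (∫⁻ t in Set.Ioi (0 : ℝ),
    rearrangement f t ^ q * ENNReal.ofReal (q / p * t ^ (q / p - 1))) ^ (1 / q)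

lemma rearrangement_antitone (f : Ω →ₘ[μ] ℝ) : Antitone (rearrangement f) := by
  intro a b hab
  refine le_iInf₂ fun s hs => iInf₂_le s ⟨hs.1, hs.2.trans (ENNReal.ofReal_le_ofReal hab)⟩

lemma rearrangement_zero {t : ℝ} : rearrangement (0 : Ω →ₘ[μ] ℝ) t = 0 := by
  refine le_antisymm (ENNReal.le_of_forall_pos_le_add fun ε hε _ => ?_) bot_le
  rw [zero_add]
  refine iInf₂_le ε ⟨hε, ?_⟩
  have : distribution (0 : Ω →ₘ[μ] ℝ) ε = 0 := by
    rw [distribution, ← nonpos_iff_eq_zero]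
    refine (measure_mono_ae ?_).trans (measure_empty (μ := μ)).le
    filter_upwards [AEEqFun.coeFn_zero (α := Ω) (μ := μ) (β := ℝ)] with x hx h
    have h' : (ε : ℝ) < |(0 : Ω →ₘ[μ] ℝ) x| := h
    rw [hx] at h'
    simp only [Pi.zero_apply, abs_zero] at h'
    exact absurd h' (not_lt.2 ε.2)
  simp [this]

lemma rearrangement_add_le (f g : Ω →ₘ[μ] ℝ) {t : ℝ} (ht : 0 < t) :
    rearrangement (f + g) (2 * t) ≤ rearrangement f t + rearrangement g t := by
  simp only [rearrangement]
  refine ENNReal.le_iInf₂_add_iInf₂ fun a ha b hb => ?_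
  rw [← ENNReal.coe_add]
  refine iInf₂_le (a + b) ⟨add_pos ha.1 hb.1, ?_⟩
  have h : distribution (f + g) (a + b) ≤ distribution f a + distribution g b := by
    refine le_trans ?_ (measure_union_le _ _)
    refine measure_mono_ae ?_
    filter_upwards [AEEqFun.coeFn_add f g] with x hx h
    have h' : ((a + b : ℝ≥0) : ℝ) < |(f + g) x| := h
    rw [hx] at h'
    by_contra hn
    have hn' : ¬ ((a : ℝ) < |f x| ∨ (b : ℝ) < |g x|) := hn
    push Not at hn'
    have := abs_add_le (f x) (g x)
    simp only [Pi.add_apply, NNReal.coe_add] at h'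
    linarith
  refine h.trans ((add_le_add ha.2 hb.2).trans ?_)
  rw [← ENNReal.ofReal_add ht.le ht.le, two_mul]

lemma rearrangement_smul_le (r : ℝ) (f : Ω →ₘ[μ] ℝ) (t : ℝ) :
    rearrangement (r • f) t ≤ ‖r‖₊ * rearrangement f t := by
  rcases eq_or_ne r 0 with rfl | hr
  · simp [rearrangement_zero]
  have hr' : 0 < ‖r‖₊ := nnnorm_pos.2 hr
  rw [mul_comm, ← ENNReal.div_le_iff (by simpa using hr) ENNReal.coe_ne_top]
  refine le_iInf₂ fun s hs => ?_
  rw [ENNReal.div_le_iff (by simpa using hr) ENNReal.coe_ne_top, ← ENNReal.coe_mul]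
  refine iInf₂_le (s * ‖r‖₊) ⟨mul_pos hs.1 hr', le_trans ?_ hs.2⟩
  refine measure_mono_ae ?_
  filter_upwards [AEEqFun.coeFn_smul r f] with x hx h
  have h' : ((s * ‖r‖₊ : ℝ≥0) : ℝ) < |(r • f) x| := h
  rw [hx] at h'
  simp only [NNReal.coe_mul, coe_nnnorm, Real.norm_eq_abs, Pi.smul_apply, smul_eq_mul,
    abs_mul] at h'
  rw [mul_comm] at h'
  exact lt_of_mul_lt_mul_left h' (abs_nonneg r)

lemma lorentzENorm_lt_top_iff {p q : ℝ} (hq : 0 < q) (f : Ω →ₘ[μ] ℝ) :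
    lorentzENorm p q f < ∞ ↔ ∫⁻ t in Set.Ioi (0 : ℝ),
      rearrangement f t ^ q * ENNReal.ofReal (q / p * t ^ (q / p - 1)) < ∞ := by
  rw [lorentzENorm, ENNReal.rpow_lt_top_iff_of_pos (by positivity)]

lemma lorentzENorm_zero {p q : ℝ} (hq : 0 < q) : lorentzENorm p q (0 : Ω →ₘ[μ] ℝ) = 0 := by
  simp [lorentzENorm, rearrangement_zero, hq]

lemma lorentzENorm_add_lt_top {p q : ℝ} (hq : 1 ≤ q) {f g : Ω →ₘ[μ] ℝ}
    (hf : lorentzENorm p q f < ∞) (hg : lorentzENorm p q g < ∞) :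
    lorentzENorm p q (f + g) < ∞ := by
  have hq0 : 0 < q := by linarith
  rw [lorentzENorm_lt_top_iff hq0] at hf hg ⊢
  set w : ℝ → ℝ≥0∞ := fun t => ENNReal.ofReal (q / p * t ^ (q / p - 1)) with hw
  have hwm : Measurable w := by fun_prop
  have hm : ∀ h : Ω →ₘ[μ] ℝ, Measurable fun t => rearrangement h t ^ q * w t := fun h =>
    ((rearrangement_antitone h).measurable.pow_const q).mul hwm
  have hw2 : ∀ u ∈ Set.Ioi (0 : ℝ), w (2 * u) = ENNReal.ofReal (2 ^ (q / p - 1)) * w u := by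
    intro u hu
    have hu' : (0 : ℝ) < u := hu
    simp only [hw]
    rw [← ENNReal.ofReal_mul (by positivity), Real.mul_rpow (by norm_num) hu'.le]
    congr 1
    ring
  set K : ℝ≥0∞ := ENNReal.ofReal (2 ^ (q / p - 1)) * 2 ^ (q - 1) with hK
  have hKt : K ≠ ∞ := ENNReal.mul_ne_top ENNReal.ofReal_ne_top
    (ENNReal.rpow_ne_top_of_nonneg (by linarith) (by norm_num))
  have key : ∫⁻ t in Set.Ioi (0 : ℝ), rearrangement (f + g) t ^ q * w t
      = ENNReal.ofReal |2| *
        ∫⁻ u in Set.Ioi (0 : ℝ), rearrangement (f + g) (2 * u) ^ q * w (2 * u) := by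
    rw [← lintegral_indicator measurableSet_Ioi, ← lintegral_indicator measurableSet_Ioi]
    conv_lhs => rw [← Real.smul_map_volume_mul_left (a := 2) two_ne_zero]
    rw [lintegral_smul_measure, lintegral_map ((hm _).indicator measurableSet_Ioi)
      (measurable_const_mul 2), smul_eq_mul]
    congr 2
    funext u
    by_cases hu : 0 < u
    · simp [Set.indicator, hu]
    · simp [Set.indicator, hu]
  rw [key]
  refine ENNReal.mul_lt_top ENNReal.ofReal_lt_top ?_
  have hle : ∫⁻ u in Set.Ioi (0 : ℝ), rearrangement (f + g) (2 * u) ^ q * w (2 * u)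
      ≤ ∫⁻ u in Set.Ioi (0 : ℝ),
        K * (rearrangement f u ^ q * w u + rearrangement g u ^ q * w u) := by
    refine setLIntegral_mono' measurableSet_Ioi fun u hu => ?_
    have h1 : rearrangement (f + g) (2 * u) ^ q
        ≤ 2 ^ (q - 1) * (rearrangement f u ^ q + rearrangement g u ^ q) :=
      (ENNReal.rpow_le_rpow (rearrangement_add_le f g hu) hq0.le).trans
        (ENNReal.rpow_add_le_mul_rpow_add_rpow _ _ hq)
    rw [hw2 u hu]
    calc _ ≤ 2 ^ (q - 1) * (rearrangement f u ^ q + rearrangement g u ^ q) *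
          (ENNReal.ofReal (2 ^ (q / p - 1)) * w u) := by gcongr
      _ = _ := by rw [hK]; ring
  refine hle.trans_lt ?_
  rw [lintegral_const_mul' _ _ hKt, lintegral_add_left (hm f)]
  exact ENNReal.mul_lt_top hKt.lt_top (ENNReal.add_lt_top.2 ⟨hf, hg⟩)

lemma lorentzENorm_smul_lt_top {p q : ℝ} (hq : 1 ≤ q) (r : ℝ) {f : Ω →ₘ[μ] ℝ}
    (hf : lorentzENorm p q f < ∞) : lorentzENorm p q (r • f) < ∞ := by
  have hq0 : 0 < q := by linarith
  rw [lorentzENorm_lt_top_iff hq0] at hf ⊢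
  have hc : (‖r‖₊ : ℝ≥0∞) ^ q ≠ ∞ := ENNReal.rpow_ne_top_of_nonneg hq0.le ENNReal.coe_ne_top
  refine lt_of_le_of_lt (lintegral_mono (g := fun t => (‖r‖₊ : ℝ≥0∞) ^ q *
    (rearrangement f t ^ q * ENNReal.ofReal (q / p * t ^ (q / p - 1)))) fun t => ?_) ?_
  · beta_reduce
    rw [← mul_assoc, ← ENNReal.mul_rpow_of_nonneg _ _ hq0.le]
    gcongr
    exact rearrangement_smul_le r f t
  · rw [lintegral_const_mul' _ _ hc]
    exact ENNReal.mul_lt_top hc.lt_top hf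

/-- The real Lorentz space `L_{p,q}(Ω)`: classes of measurable functions, modulo equality almost
everywhere, with finite Lorentz functional. -/
def LorentzSpace (p q : ℝ) [Fact (1 ≤ q)] (μ : Measure Ω) : Submodule ℝ (Ω →ₘ[μ] ℝ) where
  carrier := {f | lorentzENorm p q f < ∞}
  zero_mem' := by
    have hq : (1 : ℝ) ≤ q := Fact.out
    simp [lorentzENorm_zero (p := p) (by linarith : 0 < q)]
  add_mem' := lorentzENorm_add_lt_top Fact.out
  smul_mem' r _ := lorentzENorm_smul_lt_top Fact.out r

/-- The functional `‖f‖_{p,q}` on `L_{p,q}(Ω)`: a norm for `q ≤ p`, a quasi-norm for `p < q`. -/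
instance LorentzSpace.instNorm (p q : ℝ) [Fact (1 ≤ q)] (μ : Measure Ω) :
    Norm (LorentzSpace p q μ) where
  norm f := (lorentzENorm p q (f : Ω →ₘ[μ] ℝ)).toReal

end Lorentz

/-- Isomorphism of (quasi-)normed real vector spaces: a linear bijection that is bounded and whose
inverse is bounded. On a product `X × Y` the norm is the maximum of the norms. -/
def BanachIsomorphic (X Y : Type*) [AddCommGroup X] [Module ℝ X] [Norm X]
    [AddCommGroup Y] [Module ℝ Y] [Norm Y] : Prop :=
  ∃ (T : X ≃ₗ[ℝ] Y) (C : ℝ), (∀ x, ‖T x‖ ≤ C * ‖x‖) ∧ ∀ y, ‖T.symm y‖ ≤ C * ‖y‖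

/-! ### Atomic measure spaces -/

/-- `A` is an atom of `μ`: a measurable set of positive measure such that every measurable part of
`A` is null or of null complement in `A`. -/
def IsMeasureAtom {Ω : Type*} [MeasurableSpace Ω] (μ : Measure Ω) (A : Set Ω) : Prop :=
  MeasurableSet A ∧ 0 < μ A ∧ ∀ B ⊆ A, MeasurableSet B → μ B = 0 ∨ μ (A \ B) = 0

/-- A measure space that is the disjoint union of a sequence of atoms of finite measure. -/
structure AtomicSpace : Type (u + 1) where
  carrier : Type u
  [measurableSpace : MeasurableSpace carrier]
  measure : Measure carrier
  atom : ℕ → Set carrier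
  isMeasureAtom : ∀ n, IsMeasureAtom measure (atom n)
  disjoint : Pairwise fun m n => Disjoint (atom m) (atom n)
  iUnion_atom : ⋃ n, atom n = Set.univ
  finite : ∀ n, measure (atom n) < ∞

namespace AtomicSpace

attribute [instance] AtomicSpace.measurableSpace

/-- The measure of the `n`-th atom. -/
def mass (𝒜 : AtomicSpace.{u}) (n : ℕ) : ℝ≥0∞ := 𝒜.measure (𝒜.atom n)

/-- The space `ℓ_{p,q}({A_n})`. -/
abbrev ell (p q : ℝ) [Fact (1 ≤ q)] (𝒜 : AtomicSpace.{u}) : Type u :=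
  LorentzSpace p q 𝒜.measure

/-- Case (i): `ℓ_{p,q}({A_n})` is of type `ℓ_{p,q,0}`. -/
def IsTypeZero (𝒜 : AtomicSpace.{u}) : Prop := Tendsto 𝒜.mass atTop (𝓝 0)

/-- Case (ii): `ℓ_{p,q}({A_n})` is of type `ℓ_{p,q,∞}`. -/
def IsTypeInfty (𝒜 : AtomicSpace.{u}) : Prop := Tendsto 𝒜.mass atTop (𝓝 ∞)

/-- Case (iii): `ℓ_{p,q}({A_n})` is of type `ℓ_{p,q,1}`. -/
def IsTypeOne (𝒜 : AtomicSpace.{u}) : Prop :=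
  0 < liminf 𝒜.mass atTop ∧ liminf 𝒜.mass atTop ≤ limsup 𝒜.mass atTop ∧
    limsup 𝒜.mass atTop < ∞

/-- Case (iv). -/
def IsTypeIV (𝒜 : AtomicSpace.{u}) : Prop :=
  0 = liminf 𝒜.mass atTop ∧ liminf 𝒜.mass atTop < limsup 𝒜.mass atTop ∧
    limsup 𝒜.mass atTop < ∞

/-- Case (v). -/
def IsTypeV (𝒜 : AtomicSpace.{u}) : Prop :=
  0 < liminf 𝒜.mass atTop ∧ liminf 𝒜.mass atTop < limsup 𝒜.mass atTop ∧
    limsup 𝒜.mass atTop = ∞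

/-- Case (vi). -/
def IsTypeVI (𝒜 : AtomicSpace.{u}) : Prop :=
  0 = liminf 𝒜.mass atTop ∧ liminf 𝒜.mass atTop < limsup 𝒜.mass atTop ∧
    limsup 𝒜.mass atTop = ∞

/-- For some `a > 0`, the atoms of measure `< a` have finite total measure, and for every
bound `b` only finitely many atoms have measure in `[a, b)`. Then neither the atoms themselves nor
the sums of small atoms yield a part of type `ℓ_{p,q,1}`. -/
def HasNoTypeOnePart (𝒜 : AtomicSpace.{u}) : Prop :=
  ∃ a : ℝ≥0, 0 < a ∧ (∑' n : {n // 𝒜.mass n < a}, 𝒜.mass n) < ∞ ∧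
    ∀ b : ℝ≥0, {n | (a : ℝ≥0∞) ≤ 𝒜.mass n ∧ 𝒜.mass n < b}.Finite

end AtomicSpace

end

/-! ### Isomorphisms of quasi-normed spaces -/

/-! The functional `‖f‖_{p,q}^q` is comparable to `∑ₖ 2^(kq) μ{|f| > 2^k}^(q/p)`, so only the masses
of the atoms matter, and only up to permutation and bounded factors (`ell_isomorphic`,
`isomorphic_of_equiv`). A disjoint union of families of atoms corresponds to a product of spaces.
Since `1 < p`, averaging over disjoint finite blocks of atoms is bounded by a Hardy inequality, so
the space whose masses are the block sums is complemented (`exists_complement`).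

These facts feed a Pełczyński decomposition (`isomorphic_universal`). Let `U` have every value `w l`
as a mass infinitely often. If the masses of `X` are comparable to values of `w`, and every `w l` is
at most a sum of disjoint blocks of smaller masses infinitely often, then `X ≈ U × Y` and `U × X ≈
U`, whence `X ≈ U`. There are two instances. All spaces in which the atoms below each threshold have
infinite total mass are isomorphic (`w` runs over `2^k`, `k ∈ ℤ`). All spaces with masses bounded
below, infinitely many of them bounded above, are isomorphic (`w` runs over `b 2^k`, `k ∈ ℕ`).

If (E) fails, either the first class contains the space, and also a sum of three model spaces, or
the atoms below some `a` have finite total mass while infinitely many lie in some `[a, b)`. In the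
latter case the atoms of mass at least `a` give `unit × doubling`, and the small ones, if infinitely
many, are of type zero. If they are finitely many, a type zero summand is produced artificially:
spaces with distinct powers of two as masses are all weighted `ℓ_q` (`isomorphic_lacunary`), so
`halving ≈ doubling`, and `doubling` is absorbed by `unit × doubling`. If (E) holds, cutting at `a`
suffices. -/

/-- The norm function takes no negative values. -/
class NormNonneg (X : Type*) [Norm X] : Prop where
  norm_nonneg' : ∀ x : X, 0 ≤ ‖x‖

instance {X Y : Type*} [Norm X] [Norm Y] [NormNonneg X] : NormNonneg (X × Y) where
  norm_nonneg' x := (NormNonneg.norm_nonneg' x.1).trans (le_max_left _ _)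

instance {Ω : Type*} [MeasurableSpace Ω] {μ : Measure Ω} (p q : ℝ) [Fact (1 ≤ q)] :
    NormNonneg (LorentzSpace p q μ) where
  norm_nonneg' _ := ENNReal.toReal_nonneg

namespace BanachIsomorphic

variable {X Y Z W : Type*} [AddCommGroup X] [Module ℝ X] [Norm X]
  [AddCommGroup Y] [Module ℝ Y] [Norm Y] [AddCommGroup Z] [Module ℝ Z] [Norm Z]
  [AddCommGroup W] [Module ℝ W] [Norm W]

lemma refl : BanachIsomorphic X X := ⟨LinearEquiv.refl ℝ X, 1, by simp, by simp⟩

lemma symm (h : BanachIsomorphic X Y) : BanachIsomorphic Y X := by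
  obtain ⟨T, C, h1, h2⟩ := h
  exact ⟨T.symm, C, h2, by simpa using h1⟩

lemma prodAssoc : BanachIsomorphic ((X × Y) × Z) (X × Y × Z) :=
  ⟨LinearEquiv.prodAssoc ℝ X Y Z, 1,
    fun x => by rw [one_mul]; exact (max_assoc ‖x.1.1‖ ‖x.1.2‖ ‖x.2‖).ge,
    fun x => by rw [one_mul]; exact (max_assoc ‖x.1‖ ‖x.2.1‖ ‖x.2.2‖).le⟩

variable [NormNonneg X] [NormNonneg Y] [NormNonneg Z] [NormNonneg W]

/-- Enlarging a constant needs `0 ≤ ‖x‖`, which `Norm` alone does not provide. -/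
lemma of_bounds (T : X ≃ₗ[ℝ] Y) {C D : ℝ} (hC : ∀ x, ‖T x‖ ≤ C * ‖x‖)
    (hD : ∀ y, ‖T.symm y‖ ≤ D * ‖y‖) : BanachIsomorphic X Y :=
  ⟨T, max C D,
    fun x => (hC x).trans (mul_le_mul_of_nonneg_right (le_max_left _ _)
      (NormNonneg.norm_nonneg' x)),
    fun y => (hD y).trans (mul_le_mul_of_nonneg_right (le_max_right _ _)
      (NormNonneg.norm_nonneg' y))⟩

lemma exists_nonneg (h : BanachIsomorphic X Y) :
    ∃ (T : X ≃ₗ[ℝ] Y) (C : ℝ), 0 ≤ C ∧ (∀ x, ‖T x‖ ≤ C * ‖x‖) ∧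
      ∀ y, ‖T.symm y‖ ≤ C * ‖y‖ := by
  obtain ⟨T, C, h1, h2⟩ := h
  refine ⟨T, max C 0, le_max_right _ _, fun x => (h1 x).trans ?_, fun y => (h2 y).trans ?_⟩
  · exact mul_le_mul_of_nonneg_right (le_max_left _ _) (NormNonneg.norm_nonneg' x)
  · exact mul_le_mul_of_nonneg_right (le_max_left _ _) (NormNonneg.norm_nonneg' y)

lemma trans (h : BanachIsomorphic X Y) (h' : BanachIsomorphic Y Z) : BanachIsomorphic X Z := by
  obtain ⟨T, C, hC, h1, h2⟩ := h.exists_nonneg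
  obtain ⟨S, D, hD, h3, h4⟩ := h'.exists_nonneg
  refine of_bounds (C := D * C) (D := C * D) (T.trans S) (fun x => ?_) (fun z => ?_)
  · rw [mul_assoc]
    exact (h3 _).trans (mul_le_mul_of_nonneg_left (h1 _) hD)
  · rw [mul_assoc]
    exact (h2 _).trans (mul_le_mul_of_nonneg_left (h4 _) hC)

lemma prodCongr (h : BanachIsomorphic X Y) (h' : BanachIsomorphic Z W) :
    BanachIsomorphic (X × Z) (Y × W) := by
  obtain ⟨T, C, hC, h1, h2⟩ := h.exists_nonneg
  obtain ⟨S, D, hD, h3, h4⟩ := h'.exists_nonneg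
  have key : ∀ a b c d : ℝ, 0 ≤ c → 0 ≤ d → a ≤ C * c → b ≤ D * d →
      max a b ≤ max C D * max c d := by
    intro a b c d hc hd ha hb
    refine max_le (ha.trans ?_) (hb.trans ?_)
    · exact mul_le_mul (le_max_left _ _) (le_max_left _ _) hc (hC.trans (le_max_left _ _))
    · exact mul_le_mul (le_max_right _ _) (le_max_right _ _) hd (hC.trans (le_max_left _ _))
  exact ⟨T.prodCongr S, max C D,
    fun x => key _ _ _ _ (NormNonneg.norm_nonneg' _) (NormNonneg.norm_nonneg' _) (h1 _) (h3 _),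
    fun x => key _ _ _ _ (NormNonneg.norm_nonneg' _) (NormNonneg.norm_nonneg' _) (h2 _) (h4 _)⟩

end BanachIsomorphic

/-- A bounded linear retraction `R` of a quasi-normed space splits it as the product of the range
and the kernel of `R`. -/
lemma exists_complement_of_retraction {X Z : Type} [AddCommGroup X] [Module ℝ X] [Norm X]
    [NormNonneg X] [AddCommGroup Z] [Module ℝ Z] [Norm Z] [NormNonneg Z]
    {K : ℝ} (hadd : ∀ x y : X, ‖x + y‖ ≤ K * (‖x‖ + ‖y‖)) (hneg : ∀ x : X, ‖-x‖ = ‖x‖)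
    (J : Z →ₗ[ℝ] X) (R : X →ₗ[ℝ] Z) (hRJ : ∀ z, R (J z) = z) {A B : ℝ}
    (hJ : ∀ z, ‖J z‖ ≤ A * ‖z‖) (hR : ∀ x, ‖R x‖ ≤ B * ‖x‖) :
    ∃ (Y : Type) (_ : AddCommGroup Y) (_ : Module ℝ Y) (_ : Norm Y) (_ : NormNonneg Y),
      BanachIsomorphic X (Z × Y) := by
  let : Norm (LinearMap.ker R) := ⟨fun y => ‖(y : X)‖⟩
  have : NormNonneg (LinearMap.ker R) := ⟨fun y => NormNonneg.norm_nonneg' (y : X)⟩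
  refine ⟨LinearMap.ker R, inferInstance, inferInstance, inferInstance, inferInstance, ?_⟩
  have hnn : ∀ x : X, 0 ≤ ‖x‖ := NormNonneg.norm_nonneg'
  have hnz : ∀ x : Z, 0 ≤ ‖x‖ := NormNonneg.norm_nonneg'
  have hadd' : ∀ x y : X, ‖x + y‖ ≤ |K| * (‖x‖ + ‖y‖) := fun x y =>
    (hadd x y).trans (mul_le_mul_of_nonneg_right (le_abs_self K) (add_nonneg (hnn x) (hnn y)))
  have hJ' : ∀ z, ‖J z‖ ≤ |A| * ‖z‖ := fun z =>
    (hJ z).trans (mul_le_mul_of_nonneg_right (le_abs_self A) (hnz z))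
  have hR' : ∀ x, ‖R x‖ ≤ |B| * ‖x‖ := fun x =>
    (hR x).trans (mul_le_mul_of_nonneg_right (le_abs_self B) (hnn x))
  -- The splitting `x = J (R x) + (x - J (R x))`; the kernel carries the norm of `X`.
  let T : X ≃ₗ[ℝ] Z × LinearMap.ker R :=
    { toFun := fun x => (R x, ⟨x - J (R x), by simp [hRJ]⟩)
      map_add' := fun x y => by
        ext <;> simp; abel
      map_smul' := fun r x => by
        ext <;> simp [smul_sub]
      invFun := fun zy => J zy.1 + zy.2
      left_inv := fun x => by simp
      right_inv := fun zy => by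
        have : R zy.2 = 0 := zy.2.2
        ext <;> simp [hRJ, this] }
  refine BanachIsomorphic.of_bounds T (C := max |B| (|K| * (1 + |A| * |B|)))
    (D := |K| * (|A| + 1)) (fun x => ?_) (fun zy => ?_)
  · refine max_le ?_ ?_
    · exact (hR' x).trans (mul_le_mul_of_nonneg_right (le_max_left _ _) (hnn x))
    · refine le_trans ?_ (mul_le_mul_of_nonneg_right (le_max_right _ _) (hnn x))
      change ‖x - J (R x)‖ ≤ _
      rw [sub_eq_add_neg]
      refine (hadd' _ _).trans ?_
      rw [hneg, mul_assoc]
      refine mul_le_mul_of_nonneg_left ?_ (abs_nonneg K)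
      have := (hJ' (R x)).trans (mul_le_mul_of_nonneg_left (hR' x) (abs_nonneg A))
      linarith
  · change ‖J zy.1 + zy.2‖ ≤ _
    refine (hadd' _ _).trans ?_
    rw [mul_assoc]
    refine mul_le_mul_of_nonneg_left ?_ (abs_nonneg K)
    have h1 : ‖zy.1‖ ≤ ‖zy‖ := le_max_left _ _
    have h2 : ‖(zy.2 : X)‖ ≤ ‖zy‖ := le_max_right _ _
    have := (hJ' zy.1).trans (mul_le_mul_of_nonneg_left h1 (abs_nonneg A))
    linarith

/-- Restricting a linear equivalence to the subspaces on which two extended functionals are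
finite. -/
lemma BanachIsomorphic.of_linearEquiv {V W : Type*} [AddCommGroup V] [Module ℝ V]
    [AddCommGroup W] [Module ℝ W] {P : Submodule ℝ V} {Q : Submodule ℝ W} [Norm P] [Norm Q]
    [NormNonneg P] [NormNonneg Q]
    {Φ : V → ℝ≥0∞} {Ψ : W → ℝ≥0∞} (hP : ∀ x, x ∈ P ↔ Φ x < ∞) (hQ : ∀ x, x ∈ Q ↔ Ψ x < ∞)
    (hnP : ∀ x : P, ‖x‖ = (Φ x).toReal) (hnQ : ∀ x : Q, ‖x‖ = (Ψ x).toReal)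
    (e : V ≃ₗ[ℝ] W) {C D : ℝ≥0∞} (hC : C ≠ ∞) (hD : D ≠ ∞) (h1 : ∀ x, Ψ (e x) ≤ C * Φ x)
    (h2 : ∀ x, Φ x ≤ D * Ψ (e x)) : BanachIsomorphic P Q := by
  have hmap : P.map (e : V →ₗ[ℝ] W) = Q := by
    ext y
    obtain ⟨x, rfl⟩ := e.surjective y
    simp only [Submodule.mem_map, LinearEquiv.coe_coe, EmbeddingLike.apply_eq_iff_eq,
      exists_eq_right, hP, hQ]
    exact ⟨fun h => (h1 x).trans_lt (ENNReal.mul_lt_top hC.lt_top h),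
      fun h => (h2 x).trans_lt (ENNReal.mul_lt_top hD.lt_top h)⟩
  let T : P ≃ₗ[ℝ] Q := e.ofSubmodules P Q hmap
  have hT : ∀ x : P, ((T x : Q) : W) = e x := fun x => rfl
  refine BanachIsomorphic.of_bounds T (C := C.toReal) (D := D.toReal) (fun x => ?_) fun y => ?_
  · rw [hnP, hnQ, hT, ← ENNReal.toReal_mul]
    exact ENNReal.toReal_mono (ENNReal.mul_ne_top hC ((hP _).1 x.2).ne) (h1 _)
  · obtain ⟨x, rfl⟩ := T.surjective y
    rw [LinearEquiv.symm_apply_apply, hnP, hnQ, hT, ← ENNReal.toReal_mul]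
    refine ENNReal.toReal_mono (ENNReal.mul_ne_top hD ?_) (h2 _)
    rw [← hT]
    exact ((hQ _).1 (T x).2).ne

noncomputable section

/-! ### Dyadic sums -/

lemma two_rpow_ne_zero (a : ℝ) : (2 : ℝ≥0∞) ^ a ≠ 0 :=
  (ENNReal.rpow_pos (by norm_num) (by norm_num)).ne'

lemma two_rpow_ne_top (a : ℝ) : (2 : ℝ≥0∞) ^ a ≠ ∞ :=
  ENNReal.rpow_ne_top_of_ne_zero (by norm_num) (by norm_num)

lemma two_rpow_add (a b : ℝ) : (2 : ℝ≥0∞) ^ (a + b) = 2 ^ a * 2 ^ b :=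
  ENNReal.rpow_add _ _ (by norm_num) (by norm_num)

lemma coe_two_zpow (k : ℤ) : (((2 : ℝ≥0) ^ k : ℝ≥0) : ℝ≥0∞) = (2 : ℝ≥0∞) ^ (k : ℝ) := by
  rw [ENNReal.rpow_intCast, ENNReal.coe_zpow (by norm_num)]
  simp

lemma two_zpow_lt_two_zpow_iff {j k : ℤ} : (2 : ℝ≥0) ^ j < 2 ^ k ↔ j < k :=
  zpow_lt_zpow_iff_right₀ (by norm_num)

lemma tsum_two_rpow_neg_ne_top {a : ℝ} (ha : 0 < a) :
    ∑' i : ℕ, (2 : ℝ≥0∞) ^ (-(i * a)) ≠ ∞ := by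
  have h : ∀ i : ℕ, (2 : ℝ≥0∞) ^ (-(i * a)) = ((2 : ℝ≥0∞) ^ (-a)) ^ i := by
    intro i
    rw [← ENNReal.rpow_natCast, ← ENNReal.rpow_mul]
    congr 1; ring
  simp_rw [h]
  rw [ENNReal.tsum_geometric]
  have h1 : (2 : ℝ≥0∞) ^ (-a) < 1 :=
    ENNReal.rpow_lt_one_of_one_lt_of_neg (by norm_num) (by linarith)
  simpa using (tsub_pos_of_lt h1).ne'

/-- The sum of `2 ^ (k a)` over all integers `k` with `2 ^ k < x`; it is comparable to `x ^ a`. -/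
def dyadicPower (a : ℝ) (x : ℝ≥0∞) : ℝ≥0∞ :=
  ∑' k : ℤ, if (((2 : ℝ≥0) ^ k : ℝ≥0) : ℝ≥0∞) < x then (2 : ℝ≥0∞) ^ ((k : ℝ) * a) else 0

/-- The bounding constant in `dyadicPower_le`. -/
def dyadicConst (a : ℝ) : ℝ≥0∞ := ∑' i : ℕ, (2 : ℝ≥0∞) ^ (-(i * a))

lemma one_le_dyadicConst (a : ℝ) : 1 ≤ dyadicConst a := by
  refine le_trans ?_ (ENNReal.le_tsum 0)
  simp

/-- The terms form a geometric series descending from the largest power of two below `x`. -/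
lemma dyadicPower_le {a : ℝ} (ha : 0 < a) (x : ℝ≥0∞) :
    dyadicPower a x ≤ dyadicConst a * x ^ a := by
  rcases eq_or_ne x 0 with rfl | hx0
  · simp [dyadicPower]
  rcases eq_or_ne x ∞ with rfl | hxt
  · rw [ENNReal.top_rpow_of_pos ha, ENNReal.mul_top]
    · exact le_top
    · exact (zero_lt_one.trans_le (one_le_dyadicConst a)).ne'
  lift x to ℝ≥0 using hxt
  obtain ⟨j, hj, hj'⟩ := exists_mem_Ioc_zpow (pos_iff_ne_zero.2 (by simpa using hx0) : 0 < x)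
    (by norm_num : (1 : ℝ≥0) < 2)
  have hinj : Function.Injective fun i : ℕ => j - (i : ℤ) := fun a b h => by
    simpa using h
  rw [dyadicPower, ← hinj.tsum_eq, dyadicConst, ← ENNReal.tsum_mul_right]
  · refine ENNReal.tsum_le_tsum fun i => ?_
    split_ifs with h
    · have h1 : (2 : ℝ≥0∞) ^ ((j : ℝ) * a) ≤ (x : ℝ≥0∞) ^ a := by
        rw [ENNReal.rpow_mul, ← coe_two_zpow]
        exact ENNReal.rpow_le_rpow (by exact_mod_cast hj.le) ha.le
      calc (2 : ℝ≥0∞) ^ (((j - (i : ℤ) : ℤ) : ℝ) * a)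
          = 2 ^ (-(i * a)) * 2 ^ ((j : ℝ) * a) := by
            rw [← two_rpow_add]; congr 1; push_cast; ring
        _ ≤ _ := by gcongr
    · exact zero_le
  · intro k hk
    have hk' : (2 : ℝ≥0) ^ k < x := by
      by_contra h
      simp only [Function.mem_support] at hk
      exact hk (if_neg (by exact_mod_cast h))
    have : k < j + 1 := two_zpow_lt_two_zpow_iff.1 (hk'.trans_le hj')
    refine ⟨(j - k).toNat, ?_⟩
    simp only
    omega

/-- For finite `x > 0` the largest term alone suffices; for `x = ∞` the terms are unbounded. -/
lemma rpow_le_dyadicPower {a : ℝ} (ha : 0 < a) (x : ℝ≥0∞) :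
    x ^ a ≤ 2 ^ a * dyadicPower a x := by
  rcases eq_or_ne x 0 with rfl | hx0
  · simp [ENNReal.zero_rpow_of_pos ha]
  have hmem : ∀ k : ℤ, (((2 : ℝ≥0) ^ k : ℝ≥0) : ℝ≥0∞) < x →
      (2 : ℝ≥0∞) ^ ((k : ℝ) * a) ≤ dyadicPower a x := by
    intro k hk
    refine le_trans ?_ (ENNReal.le_tsum k)
    rw [if_pos hk]
  rcases eq_or_ne x ∞ with rfl | hxt
  · have : dyadicPower a ∞ = ∞ := by
      refine ENNReal.eq_top_of_forall_nnreal_le fun r => ?_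
      obtain ⟨n, hn⟩ := pow_unbounded_of_one_lt (r ^ (1 / a)) (by norm_num : (1 : ℝ≥0) < 2)
      refine le_trans ?_ (hmem n ENNReal.coe_lt_top)
      rw [ENNReal.rpow_mul, ← coe_two_zpow, ← ENNReal.coe_rpow_of_nonneg _ ha.le]
      have : r = (r ^ (1 / a)) ^ a := by
        rw [← NNReal.rpow_mul, one_div_mul_cancel ha.ne', NNReal.rpow_one]
      rw [this, zpow_natCast]
      exact_mod_cast NNReal.rpow_le_rpow hn.le ha.le
    rw [this, ENNReal.mul_top (two_rpow_ne_zero a)]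
    exact le_top
  lift x to ℝ≥0 using hxt
  obtain ⟨j, hj, hj'⟩ := exists_mem_Ioc_zpow (pos_iff_ne_zero.2 (by simpa using hx0) : 0 < x)
    (by norm_num : (1 : ℝ≥0) < 2)
  calc (x : ℝ≥0∞) ^ a ≤ (((2 : ℝ≥0) ^ (j + 1) : ℝ≥0) : ℝ≥0∞) ^ a :=
        ENNReal.rpow_le_rpow (by exact_mod_cast hj') ha.le
    _ = 2 ^ a * 2 ^ ((j : ℝ) * a) := by
        rw [coe_two_zpow, ← ENNReal.rpow_mul, ← two_rpow_add]; congr 1; push_cast; ring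
    _ ≤ _ := by gcongr; exact hmem j (by exact_mod_cast hj)

/-- The functional `∑ₖ 2 ^ (k q) (d k) ^ (q / p)`. When `d k` is the measure of `{|f| > 2 ^ k}`, it
is comparable to the `q`-th power of the Lorentz functional of `f`. -/
def dyadicSum (p q : ℝ) (d : ℤ → ℝ≥0∞) : ℝ≥0∞ :=
  ∑' k : ℤ, (2 : ℝ≥0∞) ^ ((k : ℝ) * q) * d k ^ (q / p)

section DyadicSum

variable {p q : ℝ} {d d' : ℤ → ℝ≥0∞}

lemma dyadicSum_mono (hr : 0 ≤ q / p) (h : ∀ k, d k ≤ d' k) :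
    dyadicSum p q d ≤ dyadicSum p q d' :=
  ENNReal.tsum_le_tsum fun k => by gcongr; exact h k

lemma dyadicSum_const_mul (hr : 0 ≤ q / p) (K : ℝ≥0∞) :
    dyadicSum p q (fun k => K * d k) = K ^ (q / p) * dyadicSum p q d := by
  simp only [dyadicSum]
  rw [← ENNReal.tsum_mul_left]
  refine tsum_congr fun k => ?_
  rw [ENNReal.mul_rpow_of_nonneg _ _ hr]
  ring

lemma dyadicSum_shift (j : ℤ) :
    dyadicSum p q (fun k => d (k + j)) = 2 ^ (-(j * q)) * dyadicSum p q d := by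
  simp only [dyadicSum]
  rw [← ENNReal.tsum_mul_left, ← (Equiv.addRight j).tsum_eq fun k : ℤ =>
    (2 : ℝ≥0∞) ^ (-(j * q)) * (2 ^ ((k : ℝ) * q) * d k ^ (q / p))]
  refine tsum_congr fun k => ?_
  rw [Equiv.coe_addRight, ← mul_assoc, ← two_rpow_add]
  congr 2; push_cast; ring

/-- Comparisons of level masses usually lose some levels; a loss of `j` levels costs the factor
`2^(jq)`. -/
lemma dyadicSum_le_of_le (hr : 0 ≤ q / p) (j : ℤ) (K : ℝ≥0∞)
    (h : ∀ k, d' (k + j) ≤ K * d k) :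
    dyadicSum p q d' ≤ 2 ^ (j * q) * K ^ (q / p) * dyadicSum p q d := by
  rw [mul_assoc, ← dyadicSum_const_mul hr]
  calc dyadicSum p q d' = 2 ^ (j * q) * dyadicSum p q (fun k => d' (k + j)) := by
        rw [dyadicSum_shift, ← mul_assoc, ← two_rpow_add, add_neg_cancel, ENNReal.rpow_zero,
          one_mul]
    _ ≤ _ := by gcongr; exact dyadicSum_mono hr h

lemma dyadicSum_add_le (hr : 0 ≤ q / p) :
    dyadicSum p q (fun k => d k + d' k)
      ≤ 2 ^ (q / p) * (dyadicSum p q d + dyadicSum p q d') := by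
  simp only [dyadicSum]
  rw [← ENNReal.tsum_add, ← ENNReal.tsum_mul_left]
  refine ENNReal.tsum_le_tsum fun k => ?_
  have : (d k + d' k) ^ (q / p) ≤ 2 ^ (q / p) * (d k ^ (q / p) + d' k ^ (q / p)) := by
    rcases le_total (d k) (d' k) with h | h
    · calc (d k + d' k) ^ (q / p) ≤ (2 * d' k) ^ (q / p) := by rw [two_mul]; gcongr
        _ = 2 ^ (q / p) * d' k ^ (q / p) := ENNReal.mul_rpow_of_nonneg _ _ hr
        _ ≤ _ := by gcongr; exact le_add_self
    · calc (d k + d' k) ^ (q / p) ≤ (2 * d k) ^ (q / p) := by rw [two_mul]; gcongr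
        _ = 2 ^ (q / p) * d k ^ (q / p) := ENNReal.mul_rpow_of_nonneg _ _ hr
        _ ≤ _ := by gcongr; exact le_self_add
  calc _ ≤ 2 ^ ((k : ℝ) * q) * (2 ^ (q / p) * (d k ^ (q / p) + d' k ^ (q / p))) := by gcongr
    _ = _ := by ring

/-- A discrete Hardy inequality. -/
lemma dyadicSum_hardy (hp : 1 < p) (hq : 0 < q) : ∃ C : ℝ≥0∞, C ≠ ∞ ∧ ∀ d : ℤ → ℝ≥0∞,
    dyadicSum p q (fun k => ∑' i : ℕ, 2 ^ (i : ℝ) * d (k + i)) ≤ C * dyadicSum p q d := by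
  have hp0 : 0 < p := by linarith
  have hr : 0 < q / p := by positivity
  -- Half of the room `p - 1`: the `i`-th shift contributes `2^(i(1+δ)q/p) 2^(-iq) = 2^(-iδq/p)`,
  -- which is summable.
  set δ : ℝ := (p - 1) / 2 with hδ
  have hδ0 : 0 < δ := by rw [hδ]; linarith
  refine ⟨dyadicConst δ ^ (q / p) * dyadicConst (δ * (q / p)), ENNReal.mul_ne_top
    (ENNReal.rpow_ne_top_of_nonneg hr.le (tsum_two_rpow_neg_ne_top hδ0))
    (tsum_two_rpow_neg_ne_top (mul_pos hδ0 hr)), fun d => ?_⟩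
  have hterm : ∀ k, (∑' i : ℕ, 2 ^ (i : ℝ) * d (k + i)) ^ (q / p) ≤ dyadicConst δ ^ (q / p) *
      ∑' i : ℕ, 2 ^ (i * ((1 + δ) * (q / p))) * d (k + i) ^ (q / p) := by
    intro k
    set S := ∑' i : ℕ, (2 : ℝ≥0∞) ^ (i * ((1 + δ) * (q / p))) * d (k + i) ^ (q / p) with hS
    -- Bounding each term by the whole sum replaces Hölder's inequality and treats `q/p < 1` and
    -- `q/p ≥ 1` alike.
    have h1 : ∀ i : ℕ, 2 ^ (i * (1 + δ)) * d (k + i) ≤ S ^ (q / p)⁻¹ := by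
      intro i
      rw [ENNReal.le_rpow_inv_iff hr, ENNReal.mul_rpow_of_nonneg _ _ hr.le, ← ENNReal.rpow_mul]
      refine le_trans (le_of_eq ?_) (ENNReal.le_tsum i)
      rw [mul_assoc]
    calc (∑' i : ℕ, 2 ^ (i : ℝ) * d (k + i)) ^ (q / p)
        ≤ (dyadicConst δ * S ^ (q / p)⁻¹) ^ (q / p) := by
          gcongr
          rw [dyadicConst, ← ENNReal.tsum_mul_right]
          refine ENNReal.tsum_le_tsum fun i => ?_
          calc (2 : ℝ≥0∞) ^ (i : ℝ) * d (k + i)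
              = 2 ^ (-(i * δ)) * (2 ^ (i * (1 + δ)) * d (k + i)) := by
                rw [← mul_assoc, ← two_rpow_add]; congr 2; ring
            _ ≤ _ := by gcongr; exact h1 i
      _ = _ := by rw [ENNReal.mul_rpow_of_nonneg _ _ hr.le, ENNReal.rpow_inv_rpow hr.ne']
  calc dyadicSum p q (fun k => ∑' i : ℕ, 2 ^ (i : ℝ) * d (k + i))
      ≤ ∑' k : ℤ, 2 ^ ((k : ℝ) * q) * (dyadicConst δ ^ (q / p) *
        ∑' i : ℕ, 2 ^ (i * ((1 + δ) * (q / p))) * d (k + i) ^ (q / p)) :=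
        ENNReal.tsum_le_tsum fun k => by gcongr; exact hterm k
    _ = dyadicConst δ ^ (q / p) * ∑' i : ℕ, 2 ^ (i * ((1 + δ) * (q / p))) *
          dyadicSum p q (fun k => d (k + i)) := by
        simp only [dyadicSum, ← ENNReal.tsum_mul_left]
        rw [ENNReal.tsum_comm]
        refine tsum_congr fun i => tsum_congr fun k => ?_
        ring
    _ = _ := by
        rw [mul_assoc]
        congr 1
        rw [dyadicConst, ← ENNReal.tsum_mul_right]
        refine tsum_congr fun i => ?_
        have h2 := dyadicSum_shift (p := p) (q := q) (d := d) (i : ℤ)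
        rw [h2, ← mul_assoc, ← two_rpow_add]
        congr 2
        rw [hδ]; push_cast; field_simp; ring

end DyadicSum

/-- For a family of distinct powers of two, the sums of the `s`-th and of the `t`-th powers are
comparable after normalization. -/
lemma tsum_two_rpow_le_rpow_tsum {ι : Type*} {φ : ι → ℤ} (hφ : Function.Injective φ) {s t : ℝ}
    (hs : 0 < s) (ht : 0 < t) (S : ι → Prop) [DecidablePred S] :
    ∑' i, (if S i then (2 : ℝ≥0∞) ^ (φ i * t) else 0) ≤
      dyadicConst t * 2 ^ t * (∑' i, if S i then (2 : ℝ≥0∞) ^ (φ i * s) else 0) ^ (t / s) := by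
  set y := ∑' i, if S i then (2 : ℝ≥0∞) ^ (φ i * s) else 0 with hy
  have h1 : ∀ i, S i → (((2 : ℝ≥0) ^ φ i : ℝ≥0) : ℝ≥0∞) ≤ y ^ s⁻¹ := by
    intro i hi
    rw [ENNReal.le_rpow_inv_iff hs, coe_two_zpow, ← ENNReal.rpow_mul]
    refine le_trans ?_ (ENNReal.le_tsum i)
    rw [if_pos hi]
  -- Each `2^(φ i)` with `S i` is at most `y^(1/s)`; the factor `2` gives the strict inequality in
  -- `dyadicPower`.
  have h2 : ∑' i, (if S i then (2 : ℝ≥0∞) ^ (φ i * t) else 0) ≤ dyadicPower t (2 * y ^ s⁻¹) := by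
    refine le_trans (ENNReal.tsum_le_tsum fun i => ?_) (ENNReal.tsum_comp_le_tsum_of_injective hφ _)
    split_ifs with hi h
    · exact le_rfl
    · refine absurd (lt_of_lt_of_le ?_ (mul_le_mul_right (h1 i hi) 2)) h
      rw [two_mul]
      exact ENNReal.lt_add_right ENNReal.coe_ne_top (ENNReal.coe_ne_zero.2 (by positivity))
    · exact zero_le
    · exact zero_le
  refine h2.trans ((dyadicPower_le ht _).trans_eq ?_)
  rw [ENNReal.mul_rpow_of_nonneg _ _ ht.le, ← ENNReal.rpow_mul, mul_assoc, inv_mul_eq_div]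

end

noncomputable section

/-! ### The Lorentz functional as a dyadic sum -/

lemma setLIntegral_Ioc_rpow {r : ℝ} (hr : 0 < r) (D : ℝ≥0) :
    ∫⁻ t in Set.Ioc (0 : ℝ) D, ENNReal.ofReal (r * t ^ (r - 1)) = (D : ℝ≥0∞) ^ r := by
  have hint : IntervalIntegrable (fun t : ℝ => r * t ^ (r - 1)) volume 0 D :=
    (intervalIntegral.intervalIntegrable_rpow' (by linarith)).const_mul r
  rw [← ofReal_integral_eq_lintegral_ofReal, ← intervalIntegral.integral_of_le D.coe_nonneg,
    intervalIntegral.integral_const_mul, integral_rpow (Or.inl (by linarith)), sub_add_cancel,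
    Real.zero_rpow hr.ne', sub_zero, mul_div_cancel₀ _ hr.ne',
    ← ENNReal.ofReal_rpow_of_nonneg D.coe_nonneg hr.le, ENNReal.ofReal_coe_nnreal]
  · exact (intervalIntegrable_iff_integrableOn_Ioc_of_le D.coe_nonneg).1 hint
  · refine (ae_restrict_iff' measurableSet_Ioc).2 (ae_of_all _ fun t ht => ?_)
    exact mul_nonneg hr.le (Real.rpow_nonneg ht.1.le _)

/-- With `r = q/p`, the weight of `{t : t < D}` is the power of the distribution function in the
dyadic sum; infinite `D` is needed too. -/
lemma lintegral_rpow_lt {r : ℝ} (hr : 0 < r) (D : ℝ≥0∞) :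
    ∫⁻ t in Set.Ioi (0 : ℝ), (if ENNReal.ofReal t < D then ENNReal.ofReal (r * t ^ (r - 1)) else 0)
      = D ^ r := by
  induction D with
  | top =>
    rw [ENNReal.top_rpow_of_pos hr]
    refine ENNReal.eq_top_of_forall_nnreal_le fun x => ?_
    have : (x : ℝ≥0∞) = ((x ^ (1 / r) : ℝ≥0) : ℝ≥0∞) ^ r := by
      rw [← ENNReal.coe_rpow_of_nonneg _ hr.le, ← NNReal.rpow_mul, one_div_mul_cancel hr.ne',
        NNReal.rpow_one]
    rw [this, ← setLIntegral_Ioc_rpow hr]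
    simp only [ENNReal.ofReal_lt_top, if_true]
    exact lintegral_mono_set Set.Ioc_subset_Ioi_self
  | coe D =>
    rw [← setLIntegral_Ioc_rpow hr, ← setLIntegral_congr (Ioo_ae_eq_Ioc (μ := volume)),
      ← lintegral_indicator measurableSet_Ioi, ← lintegral_indicator measurableSet_Ioo]
    congr 1
    funext t
    by_cases ht : 0 < t
    · have : ENNReal.ofReal t < D ↔ t < D := by
        rw [← ENNReal.ofReal_coe_nnreal, ENNReal.ofReal_lt_ofReal_iff_of_nonneg ht.le]
      simp [Set.indicator, ht, this]
    · simp [Set.indicator, ht]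

/-! ### Rearrangement versus distribution function -/

section

variable {Ω : Type*} [MeasurableSpace Ω] {μ : Measure Ω}

lemma distribution_antitone (f : Ω →ₘ[μ] ℝ) : Antitone (distribution f) := by
  intro s t hst
  refine measure_mono fun x hx => ?_
  exact lt_of_le_of_lt (NNReal.coe_le_coe.2 hst) hx

lemma lt_distribution_of_lt_rearrangement (f : Ω →ₘ[μ] ℝ) {s : ℝ≥0} (hs : 0 < s) {t : ℝ}
    (h : s < rearrangement f t) : ENNReal.ofReal t < distribution f s := by
  by_contra hn
  exact absurd (iInf₂_le s ⟨hs, not_lt.1 hn⟩) (not_le.2 h)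

lemma le_rearrangement_of_lt_distribution (f : Ω →ₘ[μ] ℝ) {s : ℝ≥0} {t : ℝ}
    (h : ENNReal.ofReal t < distribution f s) : s ≤ rearrangement f t := by
  refine le_iInf₂ fun s' hs' => ?_
  by_contra hn
  have : s' ≤ s := by exact_mod_cast (not_le.1 hn).le
  exact absurd (h.trans_le (distribution_antitone f this)) (not_lt.2 hs'.2)

/-- The weight of the Lorentz functional. -/
def lorentzWeight (p q : ℝ) (t : ℝ) : ℝ≥0∞ := ENNReal.ofReal (q / p * t ^ (q / p - 1))

lemma measurable_lorentzWeight (p q : ℝ) : Measurable (lorentzWeight p q) := by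
  unfold lorentzWeight
  fun_prop

lemma measurable_lt_rearrangement (p q : ℝ) (f : Ω →ₘ[μ] ℝ) (s : ℝ≥0∞) :
    Measurable fun t => if s < rearrangement f t then lorentzWeight p q t else 0 :=
  Measurable.ite (measurableSet_lt measurable_const (rearrangement_antitone f).measurable)
    (measurable_lorentzWeight p q) measurable_const

/-- Layer-cake formula: Tonelli exchanges the sum over levels with the integral. -/
lemma lintegral_dyadicPower_rearrangement (p q : ℝ) (f : Ω →ₘ[μ] ℝ) :
    ∫⁻ t in Set.Ioi (0 : ℝ), dyadicPower q (rearrangement f t) * lorentzWeight p q t =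
      ∑' k : ℤ, 2 ^ ((k : ℝ) * q) * ∫⁻ t in Set.Ioi (0 : ℝ),
        if (((2 : ℝ≥0) ^ k : ℝ≥0) : ℝ≥0∞) < rearrangement f t then lorentzWeight p q t else 0 := by
  simp_rw [← lintegral_const_mul _ (measurable_lt_rearrangement p q f _)]
  rw [← lintegral_tsum fun k =>
    ((measurable_lt_rearrangement p q f _).const_mul _).aemeasurable]
  refine lintegral_congr fun t => ?_
  rw [dyadicPower, ← ENNReal.tsum_mul_right]
  refine tsum_congr fun k => ?_
  split_ifs <;> simp

lemma lintegral_rearrangement_le {p q : ℝ} (hp : 0 < p) (hq : 0 < q) (f : Ω →ₘ[μ] ℝ) :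
    ∫⁻ t in Set.Ioi (0 : ℝ), rearrangement f t ^ q * lorentzWeight p q t ≤
      2 ^ q * dyadicSum p q fun k => distribution f (2 ^ k) := by
  calc _ ≤ ∫⁻ t in Set.Ioi (0 : ℝ),
          2 ^ q * (dyadicPower q (rearrangement f t) * lorentzWeight p q t) := by
        refine lintegral_mono fun t => ?_
        beta_reduce
        rw [← mul_assoc]
        gcongr
        exact rpow_le_dyadicPower hq _
    _ = 2 ^ q * ∫⁻ t in Set.Ioi (0 : ℝ),
          dyadicPower q (rearrangement f t) * lorentzWeight p q t :=
        lintegral_const_mul' _ _ (two_rpow_ne_top q)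
    _ ≤ _ := by
        rw [lintegral_dyadicPower_rearrangement, dyadicSum]
        gcongr with k
        rw [← lintegral_rpow_lt (div_pos hq hp)]
        refine lintegral_mono fun t => ?_
        beta_reduce
        split_ifs with h1 h2
        · exact le_rfl
        · exact absurd (lt_distribution_of_lt_rearrangement f (by positivity) h1) h2
        · exact zero_le
        · exact le_rfl

lemma dyadicSum_distribution_le {p q : ℝ} (hp : 0 < p) (hq : 0 < q) (f : Ω →ₘ[μ] ℝ) :
    dyadicSum p q (fun k => distribution f (2 ^ k)) ≤ 2 ^ q * dyadicConst q *
      ∫⁻ t in Set.Ioi (0 : ℝ), rearrangement f t ^ q * lorentzWeight p q t := by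
  have hC : dyadicConst q ≠ ∞ := tsum_two_rpow_neg_ne_top hq
  calc dyadicSum p q (fun k => distribution f (2 ^ k))
      ≤ ∑' k : ℤ, 2 ^ ((k : ℝ) * q) * ∫⁻ t in Set.Ioi (0 : ℝ),
          if (((2 : ℝ≥0) ^ (k - 1) : ℝ≥0) : ℝ≥0∞) < rearrangement f t then
            lorentzWeight p q t else 0 := by
        rw [dyadicSum]
        gcongr with k
        rw [← lintegral_rpow_lt (div_pos hq hp)]
        refine lintegral_mono fun t => ?_
        beta_reduce
        split_ifs with h1 h2
        · exact le_rfl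
        -- Only `2^k ≤ f^*(t)` is known; descending to `2^(k-1)` makes it strict, at the cost of the
        -- factor `2^q`.
        · refine absurd (lt_of_lt_of_le ?_ (le_rearrangement_of_lt_distribution f h1)) h2
          exact_mod_cast two_zpow_lt_two_zpow_iff.2 (sub_one_lt k)
        · exact zero_le
        · exact le_rfl
    _ = 2 ^ q * ∫⁻ t in Set.Ioi (0 : ℝ),
          dyadicPower q (rearrangement f t) * lorentzWeight p q t := by
        rw [lintegral_dyadicPower_rearrangement, ← ENNReal.tsum_mul_left,
          ← (Equiv.addRight (1 : ℤ)).tsum_eq]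
        refine tsum_congr fun k => ?_
        rw [Equiv.coe_addRight, add_sub_cancel_right, ← mul_assoc, ← two_rpow_add]
        congr 2; push_cast; ring
    _ ≤ _ := by
        rw [mul_assoc, ← lintegral_const_mul' _ _ hC]
        refine mul_le_mul' le_rfl (lintegral_mono fun t => ?_)
        beta_reduce
        rw [← mul_assoc]
        gcongr
        exact dyadicPower_le hq _

end

/-! ### Functions on an atom -/

/-- On an atom every preimage is null or conull, and countably many measurable sets separate the
points of `ℝ`. -/
lemma IsMeasureAtom.exists_ae_eq_const {Ω : Type*} [MeasurableSpace Ω] {μ : Measure Ω} {A : Set Ω}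
    (hA : IsMeasureAtom μ A) {f : Ω → ℝ} (hf : Measurable f) :
    ∃ c, ∀ᵐ x ∂(μ.restrict A), f x = c := by
  refine exists_eventuallyEq_const_of_forall_separating MeasurableSet fun U hU => ?_
  rcases hA.2.2 (A ∩ f ⁻¹' U) Set.inter_subset_left (hA.1.inter (hf hU)) with h | h
  · right
    rw [ae_restrict_iff' hA.1, ae_iff]
    refine measure_mono_null (fun x hx => ?_) h
    simpa using hx
  · left
    rw [ae_restrict_iff' hA.1, ae_iff]
    refine measure_mono_null (fun x hx => ?_) h
    simp only [Classical.not_imp, Set.mem_ofPred_eq] at hx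
    exact ⟨hx.1, fun h => hx.2 h.2⟩

namespace AtomicSpace

variable (𝒜 : AtomicSpace.{u})

lemma exists_mem_atom (x : 𝒜.carrier) : ∃ n, x ∈ 𝒜.atom n := by
  have : x ∈ ⋃ n, 𝒜.atom n := 𝒜.iUnion_atom ▸ Set.mem_univ x
  simpa using this

/-- The index of the atom that contains a given point. -/
def index (x : 𝒜.carrier) : ℕ := (𝒜.exists_mem_atom x).choose

lemma mem_atom_index (x : 𝒜.carrier) : x ∈ 𝒜.atom (𝒜.index x) := (𝒜.exists_mem_atom x).choose_spec

lemma mem_atom_iff {x : 𝒜.carrier} {n : ℕ} : x ∈ 𝒜.atom n ↔ 𝒜.index x = n := by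
  refine ⟨fun h => ?_, fun h => h ▸ 𝒜.mem_atom_index x⟩
  by_contra hne
  exact Set.disjoint_left.1 (𝒜.disjoint hne) (𝒜.mem_atom_index x) h

lemma preimage_index (S : Set ℕ) : 𝒜.index ⁻¹' S = ⋃ n : S, 𝒜.atom n := by
  ext x
  simp [mem_atom_iff]

lemma measurable_index : Measurable 𝒜.index := by
  intro S _
  rw [preimage_index]
  exact MeasurableSet.iUnion fun n => (𝒜.isMeasureAtom n).1

lemma measure_preimage_index (S : Set ℕ) [DecidablePred (· ∈ S)] :
    𝒜.measure (𝒜.index ⁻¹' S) = ∑' n, if n ∈ S then 𝒜.mass n else 0 := by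
  rw [preimage_index, measure_iUnion (fun m n hmn => 𝒜.disjoint fun h => hmn (Subtype.ext h))
    fun n => (𝒜.isMeasureAtom n).1]
  change ∑' n : S, 𝒜.mass n = _
  rw [tsum_subtype]
  refine tsum_congr fun n => ?_
  simp [Set.indicator]

lemma mass_ne_zero (n : ℕ) : 𝒜.mass n ≠ 0 := (𝒜.isMeasureAtom n).2.1.ne'

lemma mass_ne_top (n : ℕ) : 𝒜.mass n ≠ ∞ := (𝒜.finite n).ne

lemma forall_of_ae_index {P : ℕ → Prop} (h : ∀ᵐ x ∂𝒜.measure, P (𝒜.index x)) (n : ℕ) : P n := by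
  by_contra hn
  refine 𝒜.mass_ne_zero n (measure_mono_null (fun x hx => ?_) h)
  have := 𝒜.mem_atom_iff.1 hx
  simpa [this] using hn

/-- The class of the function that is constant on each atom with given values. -/
def ofCoord : (ℕ → ℝ) →ₗ[ℝ] (𝒜.carrier →ₘ[𝒜.measure] ℝ) where
  toFun c := AEEqFun.mk (c ∘ 𝒜.index)
    ((measurable_from_nat (f := c)).comp 𝒜.measurable_index).aestronglyMeasurable
  map_add' _ _ := rfl
  map_smul' _ _ := rfl

lemma coeFn_ofCoord (c : ℕ → ℝ) : 𝒜.ofCoord c =ᵐ[𝒜.measure] c ∘ 𝒜.index := AEEqFun.coeFn_mk _ _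

/-- Atoms have positive measure, hence injectivity; measurable functions are a.e. constant on each
of the countably many atoms, hence surjectivity. -/
lemma ofCoord_bijective : Function.Bijective 𝒜.ofCoord := by
  constructor
  · intro c c' h
    funext n
    have h1 : c ∘ 𝒜.index =ᵐ[𝒜.measure] c' ∘ 𝒜.index := by
      have := 𝒜.coeFn_ofCoord c'
      rw [← h] at this
      exact (𝒜.coeFn_ofCoord c).symm.trans this
    exact 𝒜.forall_of_ae_index (P := fun n => c n = c' n) h1 n
  · intro f
    choose c hc using fun n => (𝒜.isMeasureAtom n).exists_ae_eq_const f.measurable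
    refine ⟨c, AEEqFun.ext ((𝒜.coeFn_ofCoord c).trans ?_)⟩
    have : ∀ᵐ x ∂𝒜.measure, ∀ n, x ∈ 𝒜.atom n → f x = c n :=
      ae_all_iff.2 fun n => (ae_restrict_iff' (𝒜.isMeasureAtom n).1).1 (hc n)
    filter_upwards [this] with x hx
    exact (hx _ (𝒜.mem_atom_index x)).symm

lemma distribution_ofCoord (c : ℕ → ℝ) (s : ℝ≥0) :
    distribution (𝒜.ofCoord c) s = ∑' n, if s < ‖c n‖₊ then 𝒜.mass n else 0 := by
  have := 𝒜.measure_preimage_index {n | s < ‖c n‖₊}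
  simp only [Set.mem_ofPred_eq] at this
  rw [← this]
  refine measure_congr ?_
  filter_upwards [𝒜.coeFn_ofCoord c] with x hx
  change ((s : ℝ) < |(𝒜.ofCoord c) x|) = (s < ‖c (𝒜.index x)‖₊)
  rw [hx, ← NNReal.coe_lt_coe]
  rfl

end AtomicSpace

end

noncomputable section

/-! ### Weighted sequence spaces -/

section WeightedSeq

variable {ι κ : Type*}

/-- The total mass of the indices at which a sequence exceeds `2 ^ k` in modulus. -/
def levelMass (m : ι → ℝ≥0) (c : ι → ℝ) (k : ℤ) : ℝ≥0∞ :=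
  ∑' i, if (2 : ℝ≥0) ^ k < ‖c i‖₊ then (m i : ℝ≥0∞) else 0

lemma levelMass_zero (m : ι → ℝ≥0) (k : ℤ) : levelMass m 0 k = 0 := by simp [levelMass]

lemma levelMass_neg (m : ι → ℝ≥0) (c : ι → ℝ) (k : ℤ) : levelMass m (-c) k = levelMass m c k := by
  simp [levelMass]

/-- If a sum exceeds `2^(k+1)` in modulus, one of the summands exceeds `2^k`. -/
lemma levelMass_add_le (m : ι → ℝ≥0) (c c' : ι → ℝ) (k : ℤ) :
    levelMass m (c + c') (k + 1) ≤ levelMass m c k + levelMass m c' k := by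
  simp only [levelMass]
  rw [← ENNReal.tsum_add]
  refine ENNReal.tsum_le_tsum fun i => ?_
  by_cases h : (2 : ℝ≥0) ^ (k + 1) < ‖(c + c') i‖₊
  · rw [if_pos h]
    by_cases h1 : (2 : ℝ≥0) ^ k < ‖c i‖₊
    · rw [if_pos h1]; exact le_self_add
    by_cases h2 : (2 : ℝ≥0) ^ k < ‖c' i‖₊
    · rw [if_pos h2]; exact le_add_self
    refine absurd h (not_lt.2 ?_)
    rw [zpow_add_one₀ two_ne_zero, mul_two]
    exact (nnnorm_add_le _ _).trans (add_le_add (not_lt.1 h1) (not_lt.1 h2))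
  · rw [if_neg h]; exact zero_le

lemma levelMass_smul_le (m : ι → ℝ≥0) {r : ℝ} {j : ℤ} (hr : ‖r‖₊ ≤ 2 ^ j) (c : ι → ℝ) (k : ℤ) :
    levelMass m (r • c) (k + j) ≤ levelMass m c k := by
  refine ENNReal.tsum_le_tsum fun i => ?_
  split_ifs with h1 h2
  · exact le_rfl
  · refine absurd h1 (not_lt.2 ?_)
    rw [Pi.smul_apply, smul_eq_mul, nnnorm_mul, zpow_add₀ two_ne_zero, mul_comm]
    exact mul_le_mul' (not_lt.1 h2) hr
  · exact zero_le
  · exact le_rfl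

/-- The dyadic version of the `q`-th power of the Lorentz functional of a sequence. -/
def seqPower (p q : ℝ) (m : ι → ℝ≥0) (c : ι → ℝ) : ℝ≥0∞ := dyadicSum p q (levelMass m c)

variable {p q : ℝ}

lemma seqPower_add_le (hr : 0 ≤ q / p) (m : ι → ℝ≥0) (c c' : ι → ℝ) :
    seqPower p q m (c + c') ≤
      2 ^ q * 2 ^ (q / p) * (seqPower p q m c + seqPower p q m c') := by
  have h := dyadicSum_le_of_le (p := p) (q := q) hr 1 1
    (d := fun k => levelMass m c k + levelMass m c' k) (d' := levelMass m (c + c'))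
    fun k => (levelMass_add_le m c c' k).trans_eq (one_mul _).symm
  refine h.trans ?_
  rw [ENNReal.one_rpow, mul_one, Int.cast_one, one_mul, mul_assoc]
  gcongr
  exact dyadicSum_add_le hr

lemma seqPower_smul_lt_top (hr : 0 ≤ q / p) (m : ι → ℝ≥0) (r : ℝ) {c : ι → ℝ}
    (hc : seqPower p q m c < ∞) : seqPower p q m (r • c) < ∞ := by
  obtain ⟨n, hn⟩ := pow_unbounded_of_one_lt ‖r‖₊ (by norm_num : (1 : ℝ≥0) < 2)
  have h := dyadicSum_le_of_le (p := p) (q := q) hr n 1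
    (d := levelMass m c) (d' := levelMass m (r • c))
    fun k => (levelMass_smul_le m (by simpa using hn.le) c k).trans_eq (one_mul _).symm
  refine h.trans_lt (ENNReal.mul_lt_top ?_ hc)
  rw [ENNReal.one_rpow, mul_one]
  exact (two_rpow_ne_top _).lt_top

lemma seqPower_zero (hr : 0 < q / p) (m : ι → ℝ≥0) : seqPower p q m 0 = 0 := by
  simp [seqPower, dyadicSum, levelMass_zero, ENNReal.zero_rpow_of_pos hr]

variable [hq : Fact (1 ≤ q)] [hp : Fact (1 < p)]

lemma exponent_pos (p q : ℝ) [hq : Fact (1 ≤ q)] [hp : Fact (1 < p)] : 0 < q / p :=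
  div_pos (zero_lt_one.trans_le hq.out) (zero_lt_one.trans hp.out)

/-- The Lorentz sequence space with masses `m`, given by the dyadic functional. -/
def WeightedSeq (p q : ℝ) [Fact (1 ≤ q)] [Fact (1 < p)] (m : ι → ℝ≥0) : Submodule ℝ (ι → ℝ) where
  carrier := {c | seqPower p q m c < ∞}
  zero_mem' := by simp [seqPower_zero (exponent_pos p q)]
  add_mem' := fun {c c'} hc hc' =>
    (seqPower_add_le (exponent_pos p q).le m c c').trans_lt
      (ENNReal.mul_lt_top (ENNReal.mul_lt_top (two_rpow_ne_top _).lt_top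
        (two_rpow_ne_top _).lt_top) (ENNReal.add_lt_top.2 ⟨hc, hc'⟩))
  smul_mem' := fun r _ => seqPower_smul_lt_top (exponent_pos p q).le m r

instance (m : ι → ℝ≥0) : Norm (WeightedSeq p q m) where
  norm c := (seqPower p q m c ^ (1 / q)).toReal

instance (m : ι → ℝ≥0) : NormNonneg (WeightedSeq p q m) where
  norm_nonneg' _ := ENNReal.toReal_nonneg

lemma WeightedSeq.norm_def {m : ι → ℝ≥0} (c : WeightedSeq p q m) :
    ‖c‖ = (seqPower p q m c ^ (1 / q)).toReal := rfl

lemma WeightedSeq.mem_iff {m : ι → ℝ≥0} {c : ι → ℝ} :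
    c ∈ WeightedSeq p q m ↔ seqPower p q m c ^ (1 / q) < ∞ := by
  rw [ENNReal.rpow_lt_top_iff_of_pos (one_div_pos.2 (zero_lt_one.trans_le hq.out))]
  rfl

lemma WeightedSeq.norm_neg {m : ι → ℝ≥0} (c : WeightedSeq p q m) : ‖-c‖ = ‖c‖ := by
  rw [norm_def, norm_def]
  congr 2
  change dyadicSum p q (levelMass m (-(c : ι → ℝ))) = _
  rw [funext (levelMass_neg m (c : ι → ℝ))]
  rfl

lemma rpow_one_div_le_mul {q : ℝ} (hq : 0 ≤ 1 / q) {C x y : ℝ≥0∞} (h : x ≤ C * y) :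
    x ^ (1 / q) ≤ C ^ (1 / q) * y ^ (1 / q) := by
  rw [← ENNReal.mul_rpow_of_nonneg _ _ hq]
  exact ENNReal.rpow_le_rpow h hq

lemma one_div_exponent_nonneg (q : ℝ) [hq : Fact (1 ≤ q)] : 0 ≤ 1 / q :=
  one_div_nonneg.2 (zero_le_one.trans hq.out)

lemma WeightedSeq.norm_le {m : ι → ℝ≥0} {n : κ → ℝ≥0} {C : ℝ≥0∞} (hC : C ≠ ∞)
    (c : WeightedSeq p q m) (c' : WeightedSeq p q n)
    (h : seqPower p q n c' ≤ C * seqPower p q m c) :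
    ‖c'‖ ≤ (C ^ (1 / q)).toReal * ‖c‖ := by
  rw [norm_def, norm_def, ← ENNReal.toReal_mul]
  refine ENNReal.toReal_mono (ENNReal.mul_ne_top ?_ (mem_iff.1 c.2).ne)
    (rpow_one_div_le_mul (one_div_exponent_nonneg q) h)
  exact ENNReal.rpow_ne_top_of_nonneg (one_div_exponent_nonneg q) hC

lemma WeightedSeq.norm_add_le {m : ι → ℝ≥0} : ∃ K : ℝ, ∀ c c' : WeightedSeq p q m,
    ‖c + c'‖ ≤ K * (‖c‖ + ‖c'‖) := by
  set C : ℝ≥0∞ := 2 ^ q * 2 ^ (q / p) with hC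
  have hCt : C ≠ ∞ := ENNReal.mul_ne_top (two_rpow_ne_top _) (two_rpow_ne_top _)
  have hq1 : 1 / q ≤ 1 := (div_le_one (zero_lt_one.trans_le hq.out)).2 hq.out
  refine ⟨(C ^ (1 / q)).toReal, fun c c' => ?_⟩
  have h1 := (mem_iff.1 c.2).ne
  have h2 := (mem_iff.1 c'.2).ne
  rw [norm_def, norm_def, norm_def, ← ENNReal.toReal_add h1 h2, ← ENNReal.toReal_mul]
  refine ENNReal.toReal_mono (ENNReal.mul_ne_top
    (ENNReal.rpow_ne_top_of_nonneg (one_div_exponent_nonneg q) hCt)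
    (ENNReal.add_ne_top.2 ⟨h1, h2⟩)) ?_
  refine (rpow_one_div_le_mul (one_div_exponent_nonneg q)
    (seqPower_add_le (exponent_pos p q).le m c c')).trans ?_
  gcongr
  exact ENNReal.rpow_add_le_add_rpow _ _ (one_div_exponent_nonneg q) hq1

/-- The estimates are stated for all sequences, including those of infinite norm, so that they also
show that `e` carries one space onto the other. -/
lemma WeightedSeq.isomorphic_of_linearEquiv {m : ι → ℝ≥0} {n : κ → ℝ≥0}
    (e : (ι → ℝ) ≃ₗ[ℝ] (κ → ℝ)) {C D : ℝ≥0∞} (hC : C ≠ ∞) (hD : D ≠ ∞)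
    (h1 : ∀ c, seqPower p q n (e c) ≤ C * seqPower p q m c)
    (h2 : ∀ c, seqPower p q m c ≤ D * seqPower p q n (e c)) :
    BanachIsomorphic (WeightedSeq p q m) (WeightedSeq p q n) :=
  BanachIsomorphic.of_linearEquiv (fun _ => mem_iff) (fun _ => mem_iff) norm_def norm_def e
    (ENNReal.rpow_ne_top_of_nonneg (one_div_exponent_nonneg q) hC)
    (ENNReal.rpow_ne_top_of_nonneg (one_div_exponent_nonneg q) hD)
    (fun c => rpow_one_div_le_mul (one_div_exponent_nonneg q) (h1 c))
    (fun c => rpow_one_div_le_mul (one_div_exponent_nonneg q) (h2 c))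

/-- Permuting the indices and changing the masses within constant factors. -/
lemma WeightedSeq.isomorphic_of_equiv {m : ι → ℝ≥0} {n : κ → ℝ≥0} (e : ι ≃ κ) {C : ℝ≥0}
    (h1 : ∀ i, m i ≤ C * n (e i)) (h2 : ∀ i, n (e i) ≤ C * m i) :
    BanachIsomorphic (WeightedSeq p q m) (WeightedSeq p q n) := by
  have hr := (exponent_pos p q).le
  have hC : (C : ℝ≥0∞) ^ (q / p) ≠ ∞ := ENNReal.rpow_ne_top_of_nonneg hr ENNReal.coe_ne_top
  have hlevel : ∀ c k, levelMass n (LinearEquiv.funCongrLeft ℝ ℝ e.symm c) k =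
      ∑' i, if (2 : ℝ≥0) ^ k < ‖c i‖₊ then (n (e i) : ℝ≥0∞) else 0 := by
    intro c k
    rw [levelMass, ← e.tsum_eq]
    simp [LinearEquiv.funCongrLeft_apply]
  refine isomorphic_of_linearEquiv (LinearEquiv.funCongrLeft ℝ ℝ e.symm) hC hC
    (fun c => ?_) (fun c => ?_)
  · rw [seqPower, seqPower, ← dyadicSum_const_mul hr]
    refine dyadicSum_mono hr fun k => ?_
    rw [hlevel, levelMass, ← ENNReal.tsum_mul_left]
    refine ENNReal.tsum_le_tsum fun i => ?_
    split_ifs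
    · exact_mod_cast h2 i
    · simp
  · rw [seqPower, seqPower, ← dyadicSum_const_mul hr]
    refine dyadicSum_mono hr fun k => ?_
    rw [hlevel, levelMass, ← ENNReal.tsum_mul_left]
    refine ENNReal.tsum_le_tsum fun i => ?_
    split_ifs
    · exact_mod_cast h1 i
    · simp

lemma levelMass_sumElim (m : ι → ℝ≥0) (n : κ → ℝ≥0) (c : ι ⊕ κ → ℝ) (k : ℤ) :
    levelMass (Sum.elim m n) c k = levelMass m (c ∘ Sum.inl) k + levelMass n (c ∘ Sum.inr) k := by
  rw [levelMass, Summable.tsum_sum ENNReal.summable ENNReal.summable]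
  rfl

/-- The space over a disjoint union is the product of the spaces over the parts. -/
lemma WeightedSeq.isomorphic_prod (m : ι → ℝ≥0) (n : κ → ℝ≥0) :
    BanachIsomorphic (WeightedSeq p q (Sum.elim m n)) (WeightedSeq p q m × WeightedSeq p q n) := by
  have hr := (exponent_pos p q).le
  have hl : ∀ c : ι ⊕ κ → ℝ, seqPower p q m (c ∘ Sum.inl) ≤ 1 * seqPower p q (Sum.elim m n) c :=
    fun c => by
      rw [one_mul]
      exact dyadicSum_mono hr fun k => by rw [levelMass_sumElim]; exact le_self_add
  have hr' : ∀ c : ι ⊕ κ → ℝ, seqPower p q n (c ∘ Sum.inr) ≤ 1 * seqPower p q (Sum.elim m n) c :=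
    fun c => by
      rw [one_mul]
      exact dyadicSum_mono hr fun k => by rw [levelMass_sumElim]; exact le_add_self
  have hsum : ∀ c : ι ⊕ κ → ℝ, seqPower p q (Sum.elim m n) c ≤ 2 ^ (q / p) *
      (seqPower p q m (c ∘ Sum.inl) + seqPower p q n (c ∘ Sum.inr)) := fun c => by
    rw [seqPower, funext (levelMass_sumElim m n c)]
    exact dyadicSum_add_le hr
  have hlm : ∀ c ∈ WeightedSeq p q (Sum.elim m n), c ∘ Sum.inl ∈ WeightedSeq p q m :=
    fun c hc => (hl c).trans_lt (ENNReal.mul_lt_top ENNReal.one_lt_top hc)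
  have hrm : ∀ c ∈ WeightedSeq p q (Sum.elim m n), c ∘ Sum.inr ∈ WeightedSeq p q n :=
    fun c hc => (hr' c).trans_lt (ENNReal.mul_lt_top ENNReal.one_lt_top hc)
  let T : WeightedSeq p q (Sum.elim m n) ≃ₗ[ℝ] WeightedSeq p q m × WeightedSeq p q n :=
    { toFun := fun c => (⟨c.1 ∘ Sum.inl, hlm _ c.2⟩, ⟨c.1 ∘ Sum.inr, hrm _ c.2⟩)
      map_add' := fun _ _ => rfl
      map_smul' := fun _ _ => rfl
      invFun := fun c => ⟨Sum.elim c.1.1 c.2.1, (hsum _).trans_lt (ENNReal.mul_lt_top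
        (two_rpow_ne_top _).lt_top (ENNReal.add_lt_top.2 ⟨c.1.2, c.2.2⟩))⟩
      left_inv := fun c => Subtype.ext (Sum.elim_comp_inl_inr _)
      right_inv := fun c => rfl }
  set K : ℝ≥0∞ := (2 ^ (q / p)) ^ (1 / q) with hK
  have hKt : K ≠ ∞ := ENNReal.rpow_ne_top_of_nonneg (one_div_exponent_nonneg q) (two_rpow_ne_top _)
  have hq1 : 1 / q ≤ 1 := (div_le_one (zero_lt_one.trans_le hq.out)).2 hq.out
  refine BanachIsomorphic.of_bounds T (C := ((1 : ℝ≥0∞) ^ (1 / q)).toReal) (D := K.toReal * 2)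
    (fun c => ?_) (fun c => ?_)
  · exact max_le (norm_le ENNReal.one_ne_top c _ (hl c)) (norm_le ENNReal.one_ne_top c _ (hr' c))
  · have h1 := (mem_iff.1 c.1.2).ne
    have h2 := (mem_iff.1 c.2.2).ne
    have h3 : ‖T.symm c‖ ≤ K.toReal * (‖c.1‖ + ‖c.2‖) := by
      rw [norm_def, norm_def, norm_def, ← ENNReal.toReal_add h1 h2, ← ENNReal.toReal_mul]
      refine ENNReal.toReal_mono (ENNReal.mul_ne_top hKt (ENNReal.add_ne_top.2 ⟨h1, h2⟩)) ?_
      refine (rpow_one_div_le_mul (one_div_exponent_nonneg q)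
        (hsum (Sum.elim c.1.1 c.2.1))).trans ?_
      gcongr
      exact ENNReal.rpow_add_le_add_rpow _ _ (one_div_exponent_nonneg q) hq1
    refine h3.trans ?_
    rw [mul_assoc, two_mul]
    have h4 : ‖c.1‖ ≤ ‖c‖ := le_max_left _ _
    have h5 : ‖c.2‖ ≤ ‖c‖ := le_max_right _ _
    gcongr

/-! ### Averaging over blocks -/

lemma tsum_sum_finset_le {B : κ → Finset ι} (hB : Pairwise fun j j' => Disjoint (B j) (B j'))
    (x : ι → ℝ≥0∞) : ∑' j, ∑ i ∈ B j, x i ≤ ∑' i, x i := by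
  have hinj : Function.Injective fun z : Σ j, B j => (z.2 : ι) := by
    rintro ⟨j, i, hi⟩ ⟨j', i', hi'⟩ h
    obtain rfl : i = i' := h
    by_cases hj : j = j'
    · subst hj; rfl
    · exact absurd hi' (Finset.disjoint_left.1 (hB hj) hi)
  refine le_trans (le_of_eq ?_) (ENNReal.tsum_comp_le_tsum_of_injective hinj x)
  rw [ENNReal.tsum_sigma']
  refine tsum_congr fun j => ?_
  exact (Finset.tsum_subtype (B j) x).symm

/-- Spreading a sequence over blocks. -/
def spread (B : κ → Finset ι) : (κ → ℝ) →ₗ[ℝ] (ι → ℝ) where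
  toFun c i := open Classical in if h : ∃ j, i ∈ B j then c h.choose else 0
  map_add' c c' := by
    funext i
    by_cases h : ∃ j, i ∈ B j <;> simp [h]
  map_smul' r c := by
    funext i
    by_cases h : ∃ j, i ∈ B j <;> simp [h]

lemma spread_apply {B : κ → Finset ι} (hB : Pairwise fun j j' => Disjoint (B j) (B j'))
    (c : κ → ℝ) {i : ι} {j : κ} (hi : i ∈ B j) : spread B c i = c j := by
  have h : ∃ j, i ∈ B j := ⟨j, hi⟩
  have hj : h.choose = j := by
    by_contra hne
    exact Finset.disjoint_left.1 (hB hne) h.choose_spec hi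
  simp [spread, h, hj]

lemma spread_apply_of_forall_notMem {B : κ → Finset ι} (c : κ → ℝ) {i : ι}
    (hi : ∀ j, i ∉ B j) : spread B c i = 0 := by
  simp [spread, hi]

/-- A level set of `spread B c` is a union of blocks, with those `j` for which `c j` is large. -/
lemma levelMass_spread_le {B : κ → Finset ι} (hB : Pairwise fun j j' => Disjoint (B j) (B j'))
    {m : ι → ℝ≥0} {n : κ → ℝ≥0} {K : ℝ≥0} (hK : ∀ j, ∑ i ∈ B j, m i ≤ K * n j) (c : κ → ℝ) (k : ℤ) :
    levelMass m (spread B c) k ≤ K * levelMass n c k := by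
  classical
  calc levelMass m (spread B c) k
      ≤ ∑' i, ∑' j, if i ∈ B j then
          (if (2 : ℝ≥0) ^ k < ‖c j‖₊ then (m i : ℝ≥0∞) else 0) else 0 := by
        refine ENNReal.tsum_le_tsum fun i => ?_
        by_cases h : ∃ j, i ∈ B j
        · obtain ⟨j, hj⟩ := h
          refine le_trans ?_ (ENNReal.le_tsum j)
          rw [if_pos hj, spread_apply hB c hj]
        · rw [spread_apply_of_forall_notMem c (not_exists.1 h)]
          simp
    _ = ∑' j, ∑ i ∈ B j, if (2 : ℝ≥0) ^ k < ‖c j‖₊ then (m i : ℝ≥0∞) else 0 := by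
        rw [ENNReal.tsum_comm]
        refine tsum_congr fun j => ?_
        rw [tsum_eq_sum (s := B j) fun i hi => if_neg hi]
        exact Finset.sum_congr rfl fun i hi => if_pos hi
    _ ≤ _ := by
        rw [levelMass, ← ENNReal.tsum_mul_left]
        refine ENNReal.tsum_le_tsum fun j => ?_
        split_ifs
        · exact_mod_cast hK j
        · simp

/-- The weighted averages over blocks. -/
def blockAverage (m : ι → ℝ≥0) (B : κ → Finset ι) : (ι → ℝ) →ₗ[ℝ] (κ → ℝ) where
  toFun f j := (∑ i ∈ B j, (m i : ℝ) * f i) / ∑ i ∈ B j, (m i : ℝ)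
  map_add' f g := by
    funext j
    simp [mul_add, Finset.sum_add_distrib, add_div]
  map_smul' r f := by
    funext j
    simp only [Pi.smul_apply, smul_eq_mul, RingHom.id_apply]
    rw [← mul_div_assoc, Finset.mul_sum]
    congr 1
    exact Finset.sum_congr rfl fun i _ => by ring

lemma blockAverage_spread {B : κ → Finset ι} (hB : Pairwise fun j j' => Disjoint (B j) (B j'))
    {m : ι → ℝ≥0} (hm : ∀ j, 0 < ∑ i ∈ B j, m i) (c : κ → ℝ) :
    blockAverage m B (spread B c) = c := by
  funext j
  have h0 : (∑ i ∈ B j, (m i : ℝ)) ≠ 0 := by exact_mod_cast (hm j).ne'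
  change (∑ i ∈ B j, (m i : ℝ) * spread B c i) / _ = _
  rw [Finset.sum_congr rfl fun i hi => by rw [spread_apply hB c hi], ← Finset.sum_mul,
    mul_div_cancel_left₀ _ h0]

/-- When `2^(k+l) < |x| ≤ 2^(k+l+1)`, the `l`-th term alone is enough. This separates the part of a
function above level `2^k`, layer by layer. -/
lemma nnnorm_le_dyadic (x : ℝ) (k : ℤ) : (‖x‖₊ : ℝ≥0∞) ≤ (2 : ℝ≥0∞) ^ (k : ℝ) +
    2 ^ (k : ℝ) * (2 * ∑' l : ℕ, if (2 : ℝ≥0) ^ (k + l) < ‖x‖₊ then (2 : ℝ≥0∞) ^ (l : ℝ) else 0) := by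
  rcases le_or_gt ‖x‖₊ (2 ^ k) with h | h
  · refine le_trans ?_ le_self_add
    rw [← coe_two_zpow]
    exact_mod_cast h
  · refine le_trans ?_ le_add_self
    obtain ⟨j, hj, hj'⟩ := exists_mem_Ioc_zpow ((by positivity : (0 : ℝ≥0) < 2 ^ k).trans h)
      (by norm_num : (1 : ℝ≥0) < 2)
    have hkj : k ≤ j := by
      have := two_zpow_lt_two_zpow_iff.1 (h.trans_le hj')
      omega
    obtain ⟨l, rfl⟩ := Int.le.dest hkj
    calc (‖x‖₊ : ℝ≥0∞) ≤ (((2 : ℝ≥0) ^ (k + l + 1) : ℝ≥0) : ℝ≥0∞) := by exact_mod_cast hj'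
      _ = 2 ^ (k : ℝ) * (2 * 2 ^ (l : ℝ)) := by
          rw [coe_two_zpow]
          push_cast
          rw [two_rpow_add, two_rpow_add, ENNReal.rpow_one]
          ring
      _ ≤ _ := by
          gcongr
          refine le_trans ?_ (ENNReal.le_tsum l)
          rw [if_pos hj]

/-- On a block of mass `M` with average above `2^(k+1)`, values up to `2^k` account for at most `2^k
M`. The higher layers therefore account for at least `2^k M`, which bounds `M`. -/
lemma levelMass_blockAverage_le {B : κ → Finset ι}
    (hB : Pairwise fun j j' => Disjoint (B j) (B j')) {m : ι → ℝ≥0} {n : κ → ℝ≥0}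
    (hn : ∀ j, 0 < n j) (hmn : ∀ j, n j ≤ ∑ i ∈ B j, m i) (f : ι → ℝ) (k : ℤ) :
    levelMass n (blockAverage m B f) (k + 1) ≤
      2 * ∑' l : ℕ, 2 ^ (l : ℝ) * levelMass m f (k + l) := by
  set g : ι → ℝ≥0∞ := fun i =>
    ∑' l : ℕ, if (2 : ℝ≥0) ^ (k + l) < ‖f i‖₊ then (2 : ℝ≥0∞) ^ (l : ℝ) else 0 with hg
  have hblock : ∀ j, (2 : ℝ≥0) ^ (k + 1) < ‖blockAverage m B f j‖₊ →
      (n j : ℝ≥0∞) ≤ 2 * ∑ i ∈ B j, m i * g i := by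
    intro j hj
    set M : ℝ≥0 := ∑ i ∈ B j, m i with hM
    have hM0 : 0 < M := (hn j).trans_le (hmn j)
    have h1 : (2 : ℝ≥0) ^ (k + 1) * M ≤ ∑ i ∈ B j, m i * ‖f i‖₊ := by
      have : ‖blockAverage m B f j‖₊ * M ≤ ∑ i ∈ B j, m i * ‖f i‖₊ := by
        have h2 : blockAverage m B f j = (∑ i ∈ B j, (m i : ℝ) * f i) / (M : ℝ) := by
          rw [hM, NNReal.coe_sum]; rfl
        rw [h2, nnnorm_div, NNReal.nnnorm_eq, div_mul_cancel₀ _ hM0.ne']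
        refine (nnnorm_sum_le _ _).trans (Finset.sum_le_sum fun i _ => ?_)
        rw [nnnorm_mul, NNReal.nnnorm_eq]
      exact (mul_le_mul' hj.le le_rfl).trans this
    -- The common summand `2^k M` and then the factor `2^k` are cancelled below; both are finite.
    have h2 : (2 : ℝ≥0∞) ^ (k : ℝ) * M + 2 ^ (k : ℝ) * M ≤
        2 ^ (k : ℝ) * M + 2 ^ (k : ℝ) * (2 * ∑ i ∈ B j, m i * g i) := by
      calc (2 : ℝ≥0∞) ^ (k : ℝ) * M + 2 ^ (k : ℝ) * M = (((2 : ℝ≥0) ^ (k + 1) * M : ℝ≥0) : ℝ≥0∞) := by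
            rw [ENNReal.coe_mul, coe_two_zpow]
            push_cast
            rw [two_rpow_add, ENNReal.rpow_one]
            ring
        _ ≤ ∑ i ∈ B j, (m i : ℝ≥0∞) * ‖f i‖₊ := by exact_mod_cast h1
        _ ≤ ∑ i ∈ B j, (m i : ℝ≥0∞) * (2 ^ (k : ℝ) + 2 ^ (k : ℝ) * (2 * g i)) := by
            gcongr with i
            exact nnnorm_le_dyadic (f i) k
        _ = _ := by
            rw [hM, ENNReal.ofNNReal_finsetSum]
            simp only [Finset.mul_sum, ← Finset.sum_add_distrib]
            exact Finset.sum_congr rfl fun i _ => by ring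
    have h3 := (ENNReal.add_le_add_iff_left
      (ENNReal.mul_ne_top (two_rpow_ne_top _) ENNReal.coe_ne_top)).1 h2
    have h4 := (ENNReal.mul_le_mul_iff_right (two_rpow_ne_zero _) (two_rpow_ne_top _)).1 h3
    exact le_trans (by exact_mod_cast hmn j) h4
  calc levelMass n (blockAverage m B f) (k + 1) ≤ ∑' j, 2 * ∑ i ∈ B j, m i * g i := by
        refine ENNReal.tsum_le_tsum fun j => ?_
        split_ifs with h
        · exact hblock j h
        · exact zero_le
    _ ≤ 2 * ∑' i, m i * g i := by
        rw [ENNReal.tsum_mul_left]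
        gcongr
        exact tsum_sum_finset_le hB _
    _ = _ := by
        simp only [hg, levelMass, ← ENNReal.tsum_mul_left]
        rw [ENNReal.tsum_comm]
        refine tsum_congr fun l => tsum_congr fun i => ?_
        split_ifs
        · ring
        · simp

/-- The level estimate has the form of a Hardy sum; this is where `1 < p` enters. The constant
depends on `p` and `q` only. -/
lemma seqPower_blockAverage_le : ∃ C : ℝ≥0∞, C ≠ ∞ ∧ ∀ {ι κ : Type} {B : κ → Finset ι}
    (_ : Pairwise fun j j' => Disjoint (B j) (B j')) {m : ι → ℝ≥0} {n : κ → ℝ≥0}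
    (_ : ∀ j, 0 < n j) (_ : ∀ j, n j ≤ ∑ i ∈ B j, m i) (f : ι → ℝ),
    seqPower p q n (blockAverage m B f) ≤ C * seqPower p q m f := by
  have hr := (exponent_pos p q).le
  obtain ⟨C, hC, h⟩ := dyadicSum_hardy (p := p) (q := q) hp.out (zero_lt_one.trans_le hq.out)
  refine ⟨2 ^ (((1 : ℤ) : ℝ) * q) * 2 ^ (q / p) * C, ENNReal.mul_ne_top (ENNReal.mul_ne_top
    (two_rpow_ne_top _) (two_rpow_ne_top _)) hC, fun hB m n hn hmn f => ?_⟩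
  refine (dyadicSum_le_of_le hr 1 2 (levelMass_blockAverage_le hB hn hmn f)).trans ?_
  rw [mul_assoc _ C]
  gcongr
  exact h _

/-- Averaging over disjoint blocks splits off the space with the masses of the blocks. -/
lemma WeightedSeq.exists_complement {ι κ : Type} {B : κ → Finset ι}
    (hB : Pairwise fun j j' => Disjoint (B j) (B j')) {m : ι → ℝ≥0} {n : κ → ℝ≥0}
    (hn : ∀ j, 0 < n j) (hmn : ∀ j, n j ≤ ∑ i ∈ B j, m i)
    {K : ℝ≥0} (hK : ∀ j, ∑ i ∈ B j, m i ≤ K * n j) :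
    ∃ (Y : Type) (_ : AddCommGroup Y) (_ : Module ℝ Y) (_ : Norm Y) (_ : NormNonneg Y),
      BanachIsomorphic (WeightedSeq p q m) (WeightedSeq p q n × Y) := by
  have hr := (exponent_pos p q).le
  obtain ⟨C, hC, hR⟩ := seqPower_blockAverage_le (p := p) (q := q)
  have hKt : (K : ℝ≥0∞) ^ (q / p) ≠ ∞ := ENNReal.rpow_ne_top_of_nonneg hr ENNReal.coe_ne_top
  have hJ : ∀ c, seqPower p q m (spread B c) ≤ (K : ℝ≥0∞) ^ (q / p) * seqPower p q n c := by
    intro c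
    rw [seqPower, seqPower, ← dyadicSum_const_mul hr]
    exact dyadicSum_mono hr fun k => levelMass_spread_le hB hK c k
  obtain ⟨A, hA⟩ := norm_add_le (p := p) (q := q) (m := m)
  refine exists_complement_of_retraction hA norm_neg
    ((spread B).restrict (p := WeightedSeq p q n) (q := WeightedSeq p q m)
      fun c hc => (hJ c).trans_lt (ENNReal.mul_lt_top hKt.lt_top hc))
    ((blockAverage m B).restrict (p := WeightedSeq p q m) (q := WeightedSeq p q n)
      fun c hc => (hR hB hn hmn c).trans_lt (ENNReal.mul_lt_top hC.lt_top hc))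
    (fun c => Subtype.ext (blockAverage_spread hB (fun j => (hn j).trans_le (hmn j)) _))
    (fun c => norm_le hKt _ _ (hJ c)) (fun c => norm_le hC _ _ (hR hB hn hmn c))

end WeightedSeq

end

noncomputable section

variable {p q : ℝ} [hq : Fact (1 ≤ q)] [hp : Fact (1 < p)]

/-! ### Atomic spaces and weighted sequence spaces -/

namespace AtomicSpace

lemma ell_isomorphic (𝒜 : AtomicSpace.{u}) :
    BanachIsomorphic (𝒜.ell p q) (WeightedSeq p q fun n => (𝒜.mass n).toNNReal) := by
  have hp0 : 0 < p := zero_lt_one.trans hp.out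
  have hq0 : 0 < q := zero_lt_one.trans_le hq.out
  have hlevel : ∀ c, levelMass (fun n => (𝒜.mass n).toNNReal) c =
      fun k => distribution (𝒜.ofCoord c) (2 ^ k) := by
    intro c
    funext k
    rw [distribution_ofCoord, levelMass]
    simp only [ENNReal.coe_toNNReal (𝒜.mass_ne_top _)]
  refine BanachIsomorphic.symm (BanachIsomorphic.of_linearEquiv
    (Φ := fun c => seqPower p q (fun n => (𝒜.mass n).toNNReal) c ^ (1 / q))
    (Ψ := lorentzENorm p q) (fun _ => WeightedSeq.mem_iff) (fun _ => Iff.rfl)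
    WeightedSeq.norm_def (fun _ => rfl) (LinearEquiv.ofBijective 𝒜.ofCoord 𝒜.ofCoord_bijective)
    (C := (2 ^ q) ^ (1 / q)) (D := (2 ^ q * dyadicConst q) ^ (1 / q)) ?_ ?_ (fun c => ?_)
    (fun c => ?_))
  · exact ENNReal.rpow_ne_top_of_nonneg (one_div_exponent_nonneg q) (two_rpow_ne_top _)
  · exact ENNReal.rpow_ne_top_of_nonneg (one_div_exponent_nonneg q)
      (ENNReal.mul_ne_top (two_rpow_ne_top _) (tsum_two_rpow_neg_ne_top hq0))
  · refine rpow_one_div_le_mul (one_div_exponent_nonneg q) ?_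
    rw [seqPower, hlevel]
    exact lintegral_rearrangement_le hp0 hq0 (𝒜.ofCoord c)
  · refine rpow_one_div_le_mul (one_div_exponent_nonneg q) ?_
    rw [seqPower, hlevel]
    exact dyadicSum_distribution_le hp0 hq0 (𝒜.ofCoord c)

/-- The natural numbers with prescribed point masses. -/
def ofMass (m : ℕ → ℝ≥0) (hm : ∀ n, 0 < m n) : AtomicSpace.{0} :=
  have hs : ∀ n, (Measure.count.withDensity fun n => (m n : ℝ≥0∞)) {n} = m n := fun n => by
    rw [withDensity_apply _ (measurableSet_singleton n), Measure.restrict_singleton]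
    simp
  { carrier := ℕ
    measure := Measure.count.withDensity fun n => (m n : ℝ≥0∞)
    atom := fun n => {n}
    isMeasureAtom := fun n => by
      refine ⟨measurableSet_singleton n, ?_, fun B hB _ => ?_⟩
      · rw [hs]
        exact_mod_cast hm n
      · rcases Set.subset_singleton_iff_eq.1 hB with rfl | rfl
        · exact Or.inl measure_empty
        · right
          rw [Set.sdiff_self, measure_empty]
    disjoint := fun a b hab => by simpa using hab
    iUnion_atom := by
      ext x
      simp
    finite := fun n => by
      rw [hs]
      exact ENNReal.coe_lt_top }

lemma mass_ofMass (m : ℕ → ℝ≥0) (hm : ∀ n, 0 < m n) (n : ℕ) : (ofMass m hm).mass n = m n := by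
  change (Measure.count.withDensity fun n => (m n : ℝ≥0∞)) {n} = m n
  rw [withDensity_apply _ (measurableSet_singleton n), Measure.restrict_singleton]
  simp

lemma ell_ofMass_isomorphic (m : ℕ → ℝ≥0) (hm : ∀ n, 0 < m n) :
    BanachIsomorphic ((ofMass m hm).ell p q) (WeightedSeq p q m) := by
  have h := (ofMass m hm).ell_isomorphic (p := p) (q := q)
  have hm' : (fun n => ((ofMass m hm).mass n).toNNReal) = m := by
    funext n
    rw [mass_ofMass, ENNReal.toNNReal_coe]
  rwa [hm'] at h

end AtomicSpace

/-! ### Lacunary masses -/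

/-- Sums of distinct powers of two are comparable to their largest term, so the power `q/p` may be
taken termwise. Summing over the levels then leaves a weighted `ℓ_q` functional. -/
lemma seqPower_lacunary_le {ι : Type*} {φ : ι → ℤ} (hφ : Function.Injective φ) :
    ∃ C : ℝ≥0∞, C ≠ ∞ ∧ ∀ c : ι → ℝ, seqPower p q (fun i => 2 ^ φ i) c ≤
      C * ∑' i, 2 ^ (φ i * (q / p)) * (‖c i‖₊ : ℝ≥0∞) ^ q := by
  have hq0 : 0 < q := zero_lt_one.trans_le hq.out
  have hr := exponent_pos p q
  set K : ℝ≥0∞ := (dyadicConst 1 * 2) ^ (q / p) with hK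
  have hKt : K ≠ ∞ := ENNReal.rpow_ne_top_of_nonneg hr.le
    (ENNReal.mul_ne_top (tsum_two_rpow_neg_ne_top one_pos) ENNReal.ofNat_ne_top)
  refine ⟨K * dyadicConst q, ENNReal.mul_ne_top hKt (tsum_two_rpow_neg_ne_top hq0), fun c => ?_⟩
  have hlevel : ∀ k, levelMass (fun i => 2 ^ φ i) c k ^ (q / p) ≤
      K * ∑' i, if (2 : ℝ≥0) ^ k < ‖c i‖₊ then (2 : ℝ≥0∞) ^ (φ i * (q / p)) else 0 := by
    intro k
    have h := tsum_two_rpow_le_rpow_tsum hφ hr one_pos fun i => (2 : ℝ≥0) ^ k < ‖c i‖₊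
    have h' := ENNReal.rpow_le_rpow h hr.le
    rw [ENNReal.mul_rpow_of_nonneg _ _ hr.le, ← ENNReal.rpow_mul, one_div_mul_cancel hr.ne',
      ENNReal.rpow_one, ENNReal.rpow_one] at h'
    refine le_trans (le_of_eq ?_) h'
    simp only [levelMass, coe_two_zpow, mul_one]
  calc seqPower p q (fun i => 2 ^ φ i) c
      ≤ ∑' k : ℤ, 2 ^ ((k : ℝ) * q) * (K * ∑' i,
          if (2 : ℝ≥0) ^ k < ‖c i‖₊ then (2 : ℝ≥0∞) ^ (φ i * (q / p)) else 0) :=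
        ENNReal.tsum_le_tsum fun k => mul_le_mul' le_rfl (hlevel k)
    _ = K * ∑' i, 2 ^ (φ i * (q / p)) * dyadicPower q ‖c i‖₊ := by
        simp only [dyadicPower, ← ENNReal.tsum_mul_left]
        rw [ENNReal.tsum_comm]
        refine tsum_congr fun i => tsum_congr fun k => ?_
        simp only [ENNReal.coe_lt_coe]
        split_ifs
        · ring
        · simp
    _ ≤ K * ∑' i, 2 ^ (φ i * (q / p)) * (dyadicConst q * (‖c i‖₊ : ℝ≥0∞) ^ q) := by
        gcongr
        exact dyadicPower_le hq0 _
    _ = _ := by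
        simp only [← ENNReal.tsum_mul_left]
        exact tsum_congr fun i => by ring

lemma le_seqPower_lacunary {ι : Type*} {φ : ι → ℤ} (hφ : Function.Injective φ) :
    ∃ C : ℝ≥0∞, C ≠ ∞ ∧ ∀ c : ι → ℝ, ∑' i, 2 ^ (φ i * (q / p)) * (‖c i‖₊ : ℝ≥0∞) ^ q ≤
      C * seqPower p q (fun i => 2 ^ φ i) c := by
  have hq0 : 0 < q := zero_lt_one.trans_le hq.out
  have hr := exponent_pos p q
  set K : ℝ≥0∞ := dyadicConst (q / p) * 2 ^ (q / p) with hK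
  have hKt : K ≠ ∞ := ENNReal.mul_ne_top (tsum_two_rpow_neg_ne_top hr) (two_rpow_ne_top _)
  refine ⟨2 ^ q * K, ENNReal.mul_ne_top (two_rpow_ne_top _) hKt, fun c => ?_⟩
  have hlevel : ∀ k, (∑' i, if (2 : ℝ≥0) ^ k < ‖c i‖₊ then (2 : ℝ≥0∞) ^ (φ i * (q / p)) else 0) ≤
      K * levelMass (fun i => 2 ^ φ i) c k ^ (q / p) := by
    intro k
    have h := tsum_two_rpow_le_rpow_tsum hφ one_pos hr fun i => (2 : ℝ≥0) ^ k < ‖c i‖₊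
    refine h.trans (le_of_eq ?_)
    simp only [levelMass, coe_two_zpow, mul_one, div_one, hK]
  calc ∑' i, 2 ^ (φ i * (q / p)) * (‖c i‖₊ : ℝ≥0∞) ^ q
      ≤ ∑' i, 2 ^ (φ i * (q / p)) * (2 ^ q * dyadicPower q ‖c i‖₊) := by
        gcongr
        exact rpow_le_dyadicPower hq0 _
    _ = 2 ^ q * ∑' k : ℤ, 2 ^ ((k : ℝ) * q) *
          ∑' i, if (2 : ℝ≥0) ^ k < ‖c i‖₊ then (2 : ℝ≥0∞) ^ (φ i * (q / p)) else 0 := by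
        simp only [dyadicPower, ← ENNReal.tsum_mul_left]
        rw [ENNReal.tsum_comm]
        refine tsum_congr fun i => tsum_congr fun k => ?_
        simp only [ENNReal.coe_lt_coe]
        split_ifs
        · ring
        · simp
    _ ≤ 2 ^ q * ∑' k : ℤ, 2 ^ ((k : ℝ) * q) *
          (K * levelMass (fun i => 2 ^ φ i) c k ^ (q / p)) := by
        refine mul_le_mul' le_rfl (ENNReal.tsum_le_tsum fun k => mul_le_mul' le_rfl (hlevel k))
    _ = _ := by
        rw [mul_assoc, seqPower, dyadicSum]
        congr 1
        rw [← ENNReal.tsum_mul_left]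
        exact tsum_congr fun i => by ring

/-- Spaces whose masses are distinct powers of two are all isomorphic. -/
lemma WeightedSeq.isomorphic_lacunary {ι : Type*} {φ ψ : ι → ℤ} (hφ : Function.Injective φ)
    (hψ : Function.Injective ψ) :
    BanachIsomorphic (WeightedSeq p q fun i => 2 ^ φ i) (WeightedSeq p q fun i => 2 ^ ψ i) := by
  have hp0 : 0 < p := zero_lt_one.trans hp.out
  have hq0 : 0 < q := zero_lt_one.trans_le hq.out
  obtain ⟨C₁, hC₁, h₁⟩ := seqPower_lacunary_le (p := p) (q := q) hφ
  obtain ⟨C₂, hC₂, h₂⟩ := le_seqPower_lacunary (p := p) (q := q) hφ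
  obtain ⟨D₁, hD₁, k₁⟩ := seqPower_lacunary_le (p := p) (q := q) hψ
  obtain ⟨D₂, hD₂, k₂⟩ := le_seqPower_lacunary (p := p) (q := q) hψ
  -- This factor makes the diagonal map an isometry between the two weighted `ℓ_q` functionals.
  let a : ι → ℝ := fun i => (2 : ℝ) ^ (((φ i : ℝ) - ψ i) / p)
  have ha : ∀ i, a i ≠ 0 := fun i => (by positivity : (0 : ℝ) < a i).ne'
  let e : (ι → ℝ) ≃ₗ[ℝ] (ι → ℝ) :=
    LinearEquiv.piCongrRight fun i => LinearEquiv.smulOfNeZero ℝ ℝ (a i) (ha i)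
  have he : ∀ c, ∑' i, 2 ^ (ψ i * (q / p)) * (‖e c i‖₊ : ℝ≥0∞) ^ q =
      ∑' i, 2 ^ (φ i * (q / p)) * (‖c i‖₊ : ℝ≥0∞) ^ q := by
    intro c
    refine tsum_congr fun i => ?_
    have h1 : e c i = a i * c i := rfl
    have h2 : (‖a i‖₊ : ℝ≥0∞) = (2 : ℝ≥0∞) ^ (((φ i : ℝ) - ψ i) / p) := by
      rw [← enorm_eq_nnnorm, Real.enorm_of_nonneg (by positivity),
        ← ENNReal.ofReal_rpow_of_pos (by norm_num)]
      simp
    rw [h1, nnnorm_mul, ENNReal.coe_mul, ENNReal.mul_rpow_of_nonneg _ _ hq0.le, h2,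
      ← ENNReal.rpow_mul, ← mul_assoc, ← two_rpow_add]
    congr 2
    field_simp
    ring
  refine isomorphic_of_linearEquiv e (C := D₁ * C₂) (D := C₁ * D₂) (ENNReal.mul_ne_top hD₁ hC₂)
    (ENNReal.mul_ne_top hC₁ hD₂) (fun c => ?_) (fun c => ?_)
  · refine (k₁ (e c)).trans ?_
    rw [he, mul_assoc]
    exact mul_le_mul' le_rfl (h₂ c)
  · refine (h₁ c).trans ?_
    rw [← he, mul_assoc]
    exact mul_le_mul' le_rfl (k₂ (e c))

/-! ### Choosing blocks -/

/-- When terms below `x` are added one at a time, the first sum to reach `x` overshoots by less than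
`x`. -/
lemma exists_subset_sum_le {ι : Type*} {m : ι → ℝ≥0} {x : ℝ≥0} (s : Finset ι)
    (hs : ∀ i ∈ s, m i < x) (hx : x ≤ ∑ i ∈ s, m i) :
    ∃ B ⊆ s, x ≤ ∑ i ∈ B, m i ∧ ∑ i ∈ B, m i ≤ 2 * x := by
  classical
  induction s using Finset.induction_on with
  | empty => exact ⟨∅, subset_rfl, hx, by simp⟩
  | insert a s ha ih =>
    by_cases h : x ≤ ∑ i ∈ s, m i
    · obtain ⟨B, hB, h1⟩ := ih (fun i hi => hs i (Finset.mem_insert_of_mem hi)) h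
      exact ⟨B, hB.trans (Finset.subset_insert _ _), h1⟩
    · refine ⟨insert a s, subset_rfl, hx, ?_⟩
      rw [Finset.sum_insert ha, two_mul]
      exact add_le_add (hs a (Finset.mem_insert_self _ _)).le (not_le.1 h).le

lemma exists_disjoint_finset_sum {ι : Type*} {m : ι → ℝ≥0} {x : ℝ≥0}
    (h : ∑' i, (if m i < x then (m i : ℝ≥0∞) else 0) = ∞) (F : Finset ι) :
    ∃ B, Disjoint F B ∧ x ≤ ∑ i ∈ B, m i ∧ ∑ i ∈ B, m i ≤ 2 * x := by
  classical
  set y : ι → ℝ≥0 := fun i => if m i < x then m i else 0 with hy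
  have h' : ∑' i, (y i : ℝ≥0∞) = ∞ := by
    rw [← h]
    refine tsum_congr fun i => ?_
    simp only [hy]
    split_ifs <;> simp
  rw [ENNReal.tsum_eq_iSup_sum] at h'
  -- The finite sum is taken so large that at least `x` remains after the indices in `F` are
  -- discarded.
  obtain ⟨s, hs⟩ := lt_iSup_iff.1 (h' ▸ ENNReal.coe_lt_top (r := x + ∑ i ∈ F, y i))
  have hs' : x + ∑ i ∈ F, y i < ∑ i ∈ s, y i := by exact_mod_cast hs
  have h1 : ∑ i ∈ s, y i ≤ ∑ i ∈ s \ F, y i + ∑ i ∈ F, y i := by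
    refine (Finset.sum_le_sum_of_subset (Finset.subset_union_left (s₂ := F))).trans ?_
    rw [← Finset.sdiff_union_self_eq_union, Finset.sum_union Finset.sdiff_disjoint]
  have h2 : x ≤ ∑ i ∈ s \ F, y i := le_of_add_le_add_right (hs'.le.trans h1)
  have h3 : ∑ i ∈ s \ F, y i = ∑ i ∈ (s \ F).filter fun i => m i < x, m i :=
    (Finset.sum_filter _ _).symm
  obtain ⟨B, hB, h4⟩ := exists_subset_sum_le ((s \ F).filter fun i => m i < x)
    (fun i hi => (Finset.mem_filter.1 hi).2) (h3 ▸ h2)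
  exact ⟨B, Finset.disjoint_of_subset_right (hB.trans (Finset.filter_subset _ _))
    Finset.disjoint_sdiff, h4⟩

lemma exists_disjoint_blocks_nat {ι : Type*} {m : ι → ℝ≥0} {n : ℕ → ℝ≥0}
    (h : ∀ j, ∑' i, (if m i < n j then (m i : ℝ≥0∞) else 0) = ∞) :
    ∃ B : ℕ → Finset ι, (Pairwise fun j j' => Disjoint (B j) (B j')) ∧
      ∀ j, n j ≤ ∑ i ∈ B j, m i ∧ ∑ i ∈ B j, m i ≤ 2 * n j := by
  classical
  choose b hb using fun (F : Finset ι) (j : ℕ) => exists_disjoint_finset_sum (h j) F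
  -- `F k` collects the indices used by the first `k` blocks, so the next block avoids them.
  let F : ℕ → Finset ι := fun k => Nat.rec ∅ (fun k F => F ∪ b F k) k
  have hF : ∀ k, F (k + 1) = F k ∪ b (F k) k := fun k => rfl
  have hmono : Monotone F := monotone_nat_of_le_succ fun k => by
    rw [hF]
    exact Finset.subset_union_left
  have hdisj : ∀ j k, j < k → Disjoint (b (F j) j) (b (F k) k) := by
    intro j k hjk
    refine Finset.disjoint_of_subset_left ?_ (hb (F k) k).1
    refine subset_trans ?_ (hmono (Nat.succ_le_of_lt hjk))
    rw [Nat.succ_eq_add_one, hF]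
    exact Finset.subset_union_right
  refine ⟨fun k => b (F k) k, fun j k hjk => ?_, fun k => (hb (F k) k).2⟩
  rcases lt_or_gt_of_ne hjk with h | h
  · exact hdisj j k h
  · exact (hdisj k j h).symm

lemma exists_disjoint_blocks {ι κ : Type*} [Countable κ] [Infinite κ] {m : ι → ℝ≥0} {n : κ → ℝ≥0}
    (h : ∀ j, ∑' i, (if m i < n j then (m i : ℝ≥0∞) else 0) = ∞) :
    ∃ B : κ → Finset ι, (Pairwise fun j j' => Disjoint (B j) (B j')) ∧
      ∀ j, n j ≤ ∑ i ∈ B j, m i ∧ ∑ i ∈ B j, m i ≤ 2 * n j := by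
  obtain ⟨e⟩ := nonempty_equiv_of_countable (α := κ) (β := ℕ)
  obtain ⟨B, hB, hB'⟩ := exists_disjoint_blocks_nat (m := m) (n := n ∘ e.symm) fun j => h _
  refine ⟨B ∘ e, fun j j' hj => hB (e.injective.ne hj), fun j => ?_⟩
  simpa using hB' (e j)

/-! ### Universal spaces -/

namespace WeightedSeq

/-- Two spaces whose masses attain, up to constant factors, each of the values `w l` infinitely
often and no others, are isomorphic. -/
lemma isomorphic_of_levels {ι κ Λ : Type*} [Countable ι] [Countable κ] {w : Λ → ℝ≥0}
    {m : ι → ℝ≥0} {n : κ → ℝ≥0} (ℓ : ι → Λ) (ℓ' : κ → Λ) {C D : ℝ≥0}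
    (hm : ∀ i, m i ≤ C * w (ℓ i) ∧ w (ℓ i) ≤ C * m i)
    (hn : ∀ i, n i ≤ D * w (ℓ' i) ∧ w (ℓ' i) ≤ D * n i)
    (hℓ : ∀ l, Infinite {i // ℓ i = l}) (hℓ' : ∀ l, Infinite {i // ℓ' i = l}) :
    BanachIsomorphic (WeightedSeq p q m) (WeightedSeq p q n) := by
  have e : ∀ l, {i // ℓ i = l} ≃ {i // ℓ' i = l} := fun l =>
    Classical.choice nonempty_equiv_of_countable
  let E : ι ≃ κ := (Equiv.sigmaFiberEquiv ℓ).symm.trans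
    ((Equiv.sigmaCongrRight e).trans (Equiv.sigmaFiberEquiv ℓ'))
  have hE : ∀ i, ℓ' (E i) = ℓ i := fun i => (e (ℓ i) ⟨i, rfl⟩).2
  refine isomorphic_of_equiv E (C := C * D) (fun i => ?_) (fun i => ?_)
  · rw [mul_assoc]
    refine (hm i).1.trans (mul_le_mul' le_rfl ?_)
    rw [← hE]
    exact (hn _).2
  · rw [mul_comm C D, mul_assoc]
    refine (hn _).1.trans (mul_le_mul' le_rfl ?_)
    rw [hE]
    exact (hm i).2

/-- A space whose masses are comparable to values of `w`, and in which every value of `w` can be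
realized infinitely often by sums of masses, is isomorphic to the space in which each value of `w`
occurs infinitely often as a mass. -/
lemma isomorphic_universal {ι Λ : Type} [Countable ι] [Countable Λ] [Nonempty Λ] {w : Λ → ℝ≥0}
    (hw : ∀ l, 0 < w l) {m : ι → ℝ≥0} (ℓ : ι → Λ) {C : ℝ≥0}
    (hm : ∀ i, m i ≤ C * w (ℓ i) ∧ w (ℓ i) ≤ C * m i)
    (hsum : ∀ l, ∑' i, (if m i < w l then (m i : ℝ≥0∞) else 0) = ∞) :
    BanachIsomorphic (WeightedSeq p q m) (WeightedSeq p q fun z : ℕ × Λ => w z.2) := by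
  set v : ℕ × Λ → ℝ≥0 := fun z => w z.2 with hv
  have hinf : ∀ l, Infinite {z : ℕ × Λ // z.2 = l} := fun l =>
    Infinite.of_injective (fun n : ℕ => ⟨(n, l), rfl⟩) fun a b h => by simpa using h
  -- Adding a family with masses comparable to values of `w` leaves every fibre countably infinite.
  have habsorb : ∀ {κ : Type} [Countable κ] {n : κ → ℝ≥0} (ℓ' : κ → Λ) {D : ℝ≥0}
      (_ : ∀ i, n i ≤ D * w (ℓ' i) ∧ w (ℓ' i) ≤ D * n i),
      BanachIsomorphic (WeightedSeq p q v × WeightedSeq p q n) (WeightedSeq p q v) := by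
    intro κ _ n ℓ' D hn
    refine (isomorphic_prod v n).symm.trans (isomorphic_of_levels (w := w) (C := max D 1) (D := 1)
      (Sum.elim Prod.snd ℓ') Prod.snd ?_ (fun z => by simp [hv]) (fun l => ?_) hinf)
    · rintro (z | i)
      · have : v z ≤ max D 1 * v z := le_mul_of_one_le_left' (le_max_right _ _)
        exact ⟨this, this⟩
      · have h : ∀ x, D * x ≤ max D 1 * x := fun x => mul_le_mul' (le_max_left _ _) le_rfl
        exact ⟨(hn i).1.trans (h _), (hn i).2.trans (h _)⟩
    · exact Infinite.of_injective (fun n : ℕ => ⟨Sum.inl (n, l), rfl⟩) fun a b h =>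
        (Prod.ext_iff.1 (Sum.inl.inj (congrArg Subtype.val h))).1
  obtain ⟨B, hB, hB'⟩ := exists_disjoint_blocks (m := m) (n := v) fun z => hsum z.2
  obtain ⟨Y, _, _, _, _, hY⟩ := exists_complement (p := p) (q := q) hB (fun z => hw z.2)
    (fun z => (hB' z).1) (fun z => (hB' z).2)
  have hvv := habsorb (n := v) Prod.snd (D := 1) fun z => by simp [hv]
  -- Writing `X` for the given space and `V` for that with masses `v`: `X ≈ V × Y ≈ (V × V) × Y ≈ V
  -- × (V × Y) ≈ V × X ≈ V`.
  exact hY.trans ((hvv.symm.prodCongr BanachIsomorphic.refl).trans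
    (BanachIsomorphic.prodAssoc.trans ((BanachIsomorphic.refl.prodCongr hY.symm).trans
      (habsorb ℓ hm))))

/-- All spaces with atoms of arbitrarily small masses of infinite sum are isomorphic. -/
lemma isomorphic_of_tsum_small_eq_top {ι κ : Type} [Countable ι] [Countable κ] {m : ι → ℝ≥0}
    {n : κ → ℝ≥0} (hm : ∀ i, 0 < m i) (hn : ∀ i, 0 < n i)
    (hms : ∀ x : ℝ≥0, 0 < x → ∑' i, (if m i < x then (m i : ℝ≥0∞) else 0) = ∞)
    (hns : ∀ x : ℝ≥0, 0 < x → ∑' i, (if n i < x then (n i : ℝ≥0∞) else 0) = ∞) :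
    BanachIsomorphic (WeightedSeq p q m) (WeightedSeq p q n) := by
  have key : ∀ {ι : Type} [Countable ι] {m : ι → ℝ≥0} (_ : ∀ i, 0 < m i)
      (_ : ∀ x : ℝ≥0, 0 < x → ∑' i, (if m i < x then (m i : ℝ≥0∞) else 0) = ∞),
      BanachIsomorphic (WeightedSeq p q m)
        (WeightedSeq p q fun z : ℕ × ℤ => (fun k : ℤ => (2 : ℝ≥0) ^ k) z.2) := by
    intro ι _ m hm hms
    choose ℓ hℓ using fun i => exists_mem_Ioc_zpow (hm i) (by norm_num : (1 : ℝ≥0) < 2)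
    refine isomorphic_universal (w := fun k : ℤ => (2 : ℝ≥0) ^ k) (fun l => by positivity) ℓ
      (C := 2) (fun i => ⟨?_, ?_⟩) fun l => hms _ (by positivity)
    · rw [mul_comm, ← zpow_add_one₀ two_ne_zero]
      exact (hℓ i).2
    · exact (hℓ i).1.le.trans (le_mul_of_one_le_left' one_le_two)
  exact (key hm hms).trans (key hn hns).symm

/-- All spaces with masses bounded below and infinitely many masses bounded above are
isomorphic. -/
lemma isomorphic_of_bounded_below {ι κ : Type} [Countable ι] [Countable κ] {m : ι → ℝ≥0}
    {n : κ → ℝ≥0} {a a' b b' : ℝ≥0} (ha : 0 < a) (ha' : 0 < a') (hm : ∀ i, a ≤ m i)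
    (hn : ∀ i, a' ≤ n i) (hmb : {i | m i < b}.Infinite) (hnb : {i | n i < b'}.Infinite) :
    BanachIsomorphic (WeightedSeq p q m) (WeightedSeq p q n) := by
  have key : ∀ {ι : Type} [Countable ι] {m : ι → ℝ≥0} {a b : ℝ≥0} (_ : 0 < a) (_ : 0 < b)
      (_ : ∀ i, a ≤ m i) (_ : {i | m i < b}.Infinite), BanachIsomorphic (WeightedSeq p q m)
        (WeightedSeq p q fun z : ℕ × ℕ => (fun k : ℕ => b * 2 ^ k) z.2) := by
    intro ι _ m a b ha hb hm hmb
    -- Masses in `[a, b)` are assigned to level `0` at the cost `b/a`; larger ones are rounded to `b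
    -- 2^k` at the cost `2`.
    have hlevel : ∀ i, ∃ k : ℕ, m i ≤ (2 + b / a) * (b * 2 ^ k) ∧
        b * 2 ^ k ≤ (2 + b / a) * m i := by
      intro i
      by_cases h : m i < b
      · refine ⟨0, ?_, ?_⟩
        · rw [pow_zero, mul_one]
          exact h.le.trans (le_mul_of_one_le_left' (one_le_two.trans le_self_add))
        · rw [pow_zero, mul_one]
          calc b = b / a * a := (div_mul_cancel₀ _ ha.ne').symm
            _ ≤ _ := mul_le_mul' le_add_self (hm i)
      · obtain ⟨k, h1, h2⟩ := exists_nat_pow_near ((one_le_div₀ hb).2 (not_lt.1 h))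
          (by norm_num : (1 : ℝ≥0) < 2)
        rw [le_div_iff₀ hb] at h1
        rw [div_lt_iff₀ hb] at h2
        refine ⟨k, ?_, ?_⟩
        · calc m i ≤ 2 * (b * 2 ^ k) := by rw [pow_succ] at h2; exact h2.le.trans_eq (by ring)
            _ ≤ _ := mul_le_mul' le_self_add le_rfl
        · rw [mul_comm]
          exact h1.trans (le_mul_of_one_le_left' (one_le_two.trans le_self_add))
    choose ℓ hℓ using hlevel
    -- Every `b 2^l` is at least `b`, so the infinitely many masses in `[a, b)` all count, and their
    -- sum diverges.
    refine isomorphic_universal (w := fun k : ℕ => b * 2 ^ k) (fun l => by positivity) ℓ hℓ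
      fun l => ?_
    have : Infinite {i | m i < b} := hmb.to_subtype
    rw [← top_le_iff]
    calc (∞ : ℝ≥0∞) = ∑' _ : {i | m i < b}, (a : ℝ≥0∞) :=
          (ENNReal.tsum_const_eq_top_of_ne_zero (by exact_mod_cast ha.ne')).symm
      _ ≤ ∑' i : {i | m i < b}, if m i < b * 2 ^ l then (m i : ℝ≥0∞) else 0 := by
          refine ENNReal.tsum_le_tsum fun i => ?_
          have hi : m i < b := i.2
          rw [if_pos (hi.trans_le (le_mul_of_one_le_right' (one_le_pow₀ one_le_two)))]
          exact_mod_cast hm i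
      _ ≤ _ := ENNReal.tsum_comp_le_tsum_of_injective Subtype.val_injective
          fun i => if m i < b * 2 ^ l then (m i : ℝ≥0∞) else 0
  -- The model space depends on `b`, so both families need the same bound; the `1` makes it
  -- positive.
  have hb : 0 < max (max b b') 1 := lt_max_of_lt_right one_pos
  have hmb' : {i | m i < max (max b b') 1}.Infinite := hmb.mono fun i (hi : m i < b) =>
    hi.trans_le ((le_max_left _ _).trans (le_max_left _ _))
  have hnb' : {i | n i < max (max b b') 1}.Infinite := hnb.mono fun i (hi : n i < b') =>
    hi.trans_le ((le_max_right _ _).trans (le_max_left _ _))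
  exact (key ha hb hm hmb').trans (key ha' hb hn hnb').symm

/-- Splitting a space according to a property of the indices. -/
lemma isomorphic_split {ι : Type*} (m : ι → ℝ≥0) (S : ι → Prop) :
    BanachIsomorphic (WeightedSeq p q m)
      (WeightedSeq p q (fun i : {i // S i} => m i) ×
        WeightedSeq p q fun i : {i // ¬ S i} => m i) := by
  classical
  refine BanachIsomorphic.trans (BanachIsomorphic.symm ?_) (isomorphic_prod _ _)
  refine isomorphic_of_equiv (Equiv.sumCompl S) (C := 1) ?_ ?_ <;> rintro (i | i) <;> simp

end WeightedSeq

end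

noncomputable section

/-! ### The decomposition -/

/-- A tail of the harmonic series has all its terms below `x` and still diverges. -/
lemma tsum_small_one_div_eq_top {x : ℝ≥0} (hx : 0 < x) :
    ∑' n : ℕ, (if (1 / ((n : ℝ≥0) + 1)) < x then ((1 / ((n : ℝ≥0) + 1) : ℝ≥0) : ℝ≥0∞) else 0)
      = ∞ := by
  obtain ⟨N, hN⟩ := exists_nat_gt (1 / x)
  have hlt : ∀ n : ℕ, 1 / (((n + N : ℕ) : ℝ≥0) + 1) < x := fun n => by
    rw [div_lt_iff₀ (by positivity)]
    rw [div_lt_iff₀ hx] at hN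
    refine hN.trans_le ?_
    rw [mul_comm]
    gcongr
    push_cast
    exact le_add_self.trans le_self_add
  have hns : ¬ Summable fun n : ℕ => 1 / (((n + N : ℕ) : ℝ≥0) + 1) := by
    intro h
    refine Real.not_summable_one_div_natCast ?_
    have h1 := NNReal.summable_coe.2 h
    rw [← summable_nat_add_iff (N + 1)]
    refine h1.congr fun n => ?_
    push_cast
    rw [add_assoc]
  rw [← top_le_iff]
  calc (∞ : ℝ≥0∞) = ∑' n : ℕ, ((1 / (((n + N : ℕ) : ℝ≥0) + 1) : ℝ≥0) : ℝ≥0∞) := by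
        by_contra h
        exact hns (ENNReal.tsum_coe_ne_top_iff_summable.1 (Ne.symm h))
    _ = ∑' n : ℕ, (if (1 / (((n + N : ℕ) : ℝ≥0) + 1)) < x then
          ((1 / (((n + N : ℕ) : ℝ≥0) + 1) : ℝ≥0) : ℝ≥0∞) else 0) :=
        tsum_congr fun n => (if_pos (hlt n)).symm
    _ ≤ _ := ENNReal.tsum_comp_le_tsum_of_injective (add_left_injective N)
        fun n : ℕ => if (1 / ((n : ℝ≥0) + 1)) < x then
          ((1 / ((n : ℝ≥0) + 1) : ℝ≥0) : ℝ≥0∞) else 0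

namespace AtomicSpace

/-- Atoms of masses `1 / (n + 1)`. -/
def harmonic : AtomicSpace.{0} := ofMass (fun n => 1 / ((n : ℝ≥0) + 1)) fun n => by positivity

/-- Atoms of mass one. -/
def unit : AtomicSpace.{0} := ofMass (fun _ => 1) fun _ => one_pos

/-- Atoms of masses `2 ^ n`. -/
def doubling : AtomicSpace.{0} := ofMass (fun n => 2 ^ (n : ℤ)) fun n => by positivity

/-- Atoms of masses `2 ^ (-n)`. -/
def halving : AtomicSpace.{0} := ofMass (fun n => 2 ^ (-(n : ℤ))) fun n => by positivity

lemma isTypeZero_harmonic : harmonic.IsTypeZero := by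
  have h : harmonic.mass = fun n : ℕ => ((1 / ((n : ℝ≥0) + 1) : ℝ≥0) : ℝ≥0∞) :=
    funext fun n => mass_ofMass _ _ n
  rw [IsTypeZero, h, ← ENNReal.coe_zero, ENNReal.tendsto_coe]
  exact tendsto_one_div_add_atTop_nhds_zero_nat

lemma isTypeZero_halving : halving.IsTypeZero := by
  have h : halving.mass = fun n : ℕ => (((2⁻¹ : ℝ≥0) ^ n : ℝ≥0) : ℝ≥0∞) :=
    funext fun n => (mass_ofMass _ _ n).trans (by simp)
  rw [IsTypeZero, h, ← ENNReal.coe_zero, ENNReal.tendsto_coe]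
  exact tendsto_pow_atTop_nhds_zero_of_lt_one (by norm_num) (by
    rw [← NNReal.coe_lt_coe]; norm_num)

lemma isTypeOne_unit : unit.IsTypeOne := by
  have h : unit.mass = fun _ : ℕ => (1 : ℝ≥0∞) := funext fun n => mass_ofMass _ _ n
  rw [IsTypeOne, h]
  simp

lemma isTypeInfty_doubling : doubling.IsTypeInfty := by
  have h : doubling.mass = fun n : ℕ => (((2 : ℝ≥0) ^ n : ℝ≥0) : ℝ≥0∞) :=
    funext fun n => (mass_ofMass _ _ n).trans (by simp)
  rw [IsTypeInfty, h, ENNReal.tendsto_coe_nhds_top]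
  exact tendsto_pow_atTop_atTop_of_one_lt (by norm_num)

lemma mass_toNNReal_pos (𝒜 : AtomicSpace.{u}) (n : ℕ) : 0 < (𝒜.mass n).toNNReal :=
  ENNReal.toNNReal_pos (𝒜.mass_ne_zero n) (𝒜.mass_ne_top n)

lemma mass_toNNReal_lt_iff (𝒜 : AtomicSpace.{u}) {n : ℕ} {x : ℝ≥0} :
    (𝒜.mass n).toNNReal < x ↔ 𝒜.mass n < x := by
  rw [← ENNReal.coe_lt_coe, ENNReal.coe_toNNReal (𝒜.mass_ne_top n)]

/-! ### Subfamilies of atoms -/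

section Restrict

variable (𝒜 : AtomicSpace.{u}) {S : ℕ → Prop}

/-- The atomic space formed by an infinite set of the atoms. -/
def restrict (e : ℕ ≃ {n // S n}) : AtomicSpace.{0} :=
  ofMass (fun k => (𝒜.mass (e k)).toNNReal) fun _ => 𝒜.mass_toNNReal_pos _

lemma mass_restrict (e : ℕ ≃ {n // S n}) (k : ℕ) : (𝒜.restrict e).mass k = 𝒜.mass (e k) := by
  rw [restrict, mass_ofMass, ENNReal.coe_toNNReal (𝒜.mass_ne_top _)]

lemma ell_restrict_isomorphic {p q : ℝ} [Fact (1 ≤ q)] [Fact (1 < p)] (e : ℕ ≃ {n // S n}) :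
    BanachIsomorphic (WeightedSeq p q fun i : {n // S n} => (𝒜.mass i).toNNReal)
      ((𝒜.restrict e).ell p q) :=
  (WeightedSeq.isomorphic_of_equiv e.symm (C := 1) (by simp) (by simp)).trans
    (ell_ofMass_isomorphic _ _).symm

lemma isTypeZero_restrict (e : ℕ ≃ {n // S n}) (h : ∑' n : {n // S n}, 𝒜.mass n ≠ ∞) :
    (𝒜.restrict e).IsTypeZero := by
  rw [← e.tsum_eq] at h
  rw [IsTypeZero, funext (𝒜.mass_restrict e)]
  exact ENNReal.tendsto_atTop_zero_of_tsum_ne_top h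

lemma isTypeInfty_restrict (e : ℕ ≃ {n // S n})
    (h : ∀ b : ℝ≥0, {n | S n ∧ 𝒜.mass n < b}.Finite) : (𝒜.restrict e).IsTypeInfty := by
  rw [IsTypeInfty, funext (𝒜.mass_restrict e), ENNReal.tendsto_nhds_top_iff_nnreal]
  intro b
  rw [← Nat.cofinite_eq_atTop, eventually_cofinite]
  -- Masses equal to `b` must be excluded as well, hence `b + 1`.
  refine ((h (b + 1)).preimage (f := fun k => ((e k : {n // S n}) : ℕ))
    (Subtype.val_injective.comp e.injective).injOn).subset fun k hk => ?_
  refine ⟨(e k).2, lt_of_le_of_lt (not_lt.1 hk) ?_⟩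
  exact_mod_cast lt_add_one b

end Restrict

/-! ### Comparison with the model spaces -/

variable {p q : ℝ} [Fact (1 ≤ q)] [Fact (1 < p)]

/-- The harmonic summand alone puts the product into the same universal class. -/
lemma isomorphic_of_tsum_small_eq_top (𝒜 : AtomicSpace.{u}) (h : ∀ x : ℝ≥0, 0 < x →
      ∑' n, (if (𝒜.mass n).toNNReal < x then ((𝒜.mass n).toNNReal : ℝ≥0∞) else 0) = ∞) :
    BanachIsomorphic (𝒜.ell p q) (harmonic.ell p q × unit.ell p q × doubling.ell p q) := by
  refine 𝒜.ell_isomorphic.trans (BanachIsomorphic.trans (BanachIsomorphic.trans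
    (WeightedSeq.isomorphic_of_tsum_small_eq_top 𝒜.mass_toNNReal_pos ?_ h ?_)
    ((WeightedSeq.isomorphic_prod _ _).trans (BanachIsomorphic.refl.prodCongr
      (WeightedSeq.isomorphic_prod _ _))))
    ((ell_ofMass_isomorphic _ _).symm.prodCongr
      ((ell_ofMass_isomorphic _ _).symm.prodCongr (ell_ofMass_isomorphic _ _).symm)))
  · rintro (n | n | n) <;> simp only [Sum.elim_inl, Sum.elim_inr] <;> positivity
  · intro x hx
    rw [← top_le_iff, ← tsum_small_one_div_eq_top hx]
    exact ENNReal.tsum_comp_le_tsum_of_injective Sum.inl_injective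
      fun i => if Sum.elim (fun n : ℕ => 1 / ((n : ℝ≥0) + 1)) _ i < x then
        ((Sum.elim (fun n : ℕ => 1 / ((n : ℝ≥0) + 1)) _ i : ℝ≥0) : ℝ≥0∞) else 0

lemma isomorphic_unit_prod_doubling {ι : Type} [Countable ι] {m : ι → ℝ≥0} {a b : ℝ≥0}
    (ha : 0 < a) (hm : ∀ i, a ≤ m i) (hb : {i | m i < b}.Infinite) :
    BanachIsomorphic (WeightedSeq p q m) (unit.ell p q × doubling.ell p q) := by
  refine BanachIsomorphic.trans (BanachIsomorphic.trans
    (WeightedSeq.isomorphic_of_bounded_below ha one_pos (b' := 2) hm ?_ hb ?_)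
    (WeightedSeq.isomorphic_prod _ _))
    ((ell_ofMass_isomorphic _ _).symm.prodCongr (ell_ofMass_isomorphic _ _).symm)
  · rintro (n | n)
    · exact le_rfl
    · simpa using one_le_pow₀ (M₀ := ℝ≥0) one_le_two
  · refine (Set.infinite_range_of_injective (Sum.inl_injective (α := ℕ) (β := ℕ))).mono ?_
    rintro _ ⟨n, rfl⟩
    exact (one_lt_two : (1 : ℝ≥0) < 2)

/-- No masses tend to zero here, so the type zero summand is a copy of `doubling` in disguise:
`halving ≈ doubling`, and an extra `doubling` is absorbed. -/
lemma isomorphic_of_bounded_below (𝒜 : AtomicSpace.{u}) {a b : ℝ≥0} (ha : 0 < a)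
    (hm : ∀ n, a ≤ (𝒜.mass n).toNNReal) (hb : {n | (𝒜.mass n).toNNReal < b}.Infinite) :
    BanachIsomorphic (𝒜.ell p q) (halving.ell p q × unit.ell p q × doubling.ell p q) := by
  have h1 : BanachIsomorphic (doubling.ell p q) (halving.ell p q) :=
    (ell_ofMass_isomorphic _ _).trans ((WeightedSeq.isomorphic_lacunary
      (φ := fun n : ℕ => (n : ℤ)) (ψ := fun n : ℕ => -(n : ℤ)) (fun a b h => by simpa using h)
      (fun a b h => by simpa using h)).trans (ell_ofMass_isomorphic _ _).symm)
  have h2 : BanachIsomorphic (𝒜.ell p q) (unit.ell p q × doubling.ell p q) :=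
    𝒜.ell_isomorphic.trans (isomorphic_unit_prod_doubling ha hm hb)
  have h3 : BanachIsomorphic (doubling.ell p q × unit.ell p q × doubling.ell p q)
      (unit.ell p q × doubling.ell p q) := by
    refine BanachIsomorphic.trans ((ell_ofMass_isomorphic _ _).prodCongr
      ((ell_ofMass_isomorphic _ _).prodCongr (ell_ofMass_isomorphic _ _))) ?_
    refine BanachIsomorphic.trans ((BanachIsomorphic.refl.prodCongr
      (WeightedSeq.isomorphic_prod _ _).symm).trans (WeightedSeq.isomorphic_prod _ _).symm) ?_
    refine isomorphic_unit_prod_doubling one_pos (b := 2) ?_ ?_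
    · have h : ∀ n : ℕ, (1 : ℝ≥0) ≤ 2 ^ (n : ℤ) := fun n => by
        simpa using one_le_pow₀ (M₀ := ℝ≥0) one_le_two
      rintro (n | n | n)
      · exact h n
      · exact le_rfl
      · exact h n
    · refine (Set.infinite_range_of_injective (f := fun n : ℕ =>
        (Sum.inr (Sum.inl n) : ℕ ⊕ ℕ ⊕ ℕ)) fun a b h => by simpa using h).mono ?_
      rintro _ ⟨n, rfl⟩
      exact (one_lt_two : (1 : ℝ≥0) < 2)
  exact h2.trans (h3.symm.trans (h1.prodCongr BanachIsomorphic.refl))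

/-! ### The cases of condition (E) -/

lemma tsum_small_eq (𝒜 : AtomicSpace.{u}) (x : ℝ≥0) :
    ∑' n, (if (𝒜.mass n).toNNReal < x then ((𝒜.mass n).toNNReal : ℝ≥0∞) else 0) =
      ∑' n : {n // 𝒜.mass n < x}, 𝒜.mass n := by
  refine Eq.trans (tsum_congr fun n => ?_) (tsum_subtype {n | 𝒜.mass n < x} 𝒜.mass).symm
  simp only [Set.indicator, Set.mem_ofPred_eq, 𝒜.mass_toNNReal_lt_iff,
    ENNReal.coe_toNNReal (𝒜.mass_ne_top n)]
  congr

theorem exists_isomorphic_of_not_hasNoTypeOnePart (𝒜 : AtomicSpace.{u})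
    (h : ¬ 𝒜.HasNoTypeOnePart) :
    ∃ X₁ X₂ X₃ : AtomicSpace.{0}, X₁.IsTypeZero ∧ X₂.IsTypeOne ∧ X₃.IsTypeInfty ∧
      BanachIsomorphic (𝒜.ell p q) (X₁.ell p q × X₂.ell p q × X₃.ell p q) := by
  by_cases hA : ∀ x : ℝ≥0, 0 < x →
      ∑' n, (if (𝒜.mass n).toNNReal < x then ((𝒜.mass n).toNNReal : ℝ≥0∞) else 0) = ∞
  · exact ⟨harmonic, unit, doubling, isTypeZero_harmonic, isTypeOne_unit, isTypeInfty_doubling,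
      𝒜.isomorphic_of_tsum_small_eq_top hA⟩
  push Not at hA
  obtain ⟨a, ha, hsum⟩ := hA
  rw [tsum_small_eq] at hsum
  -- The atoms below this `a` have finite total mass, so (E) can fail for `a` only through its
  -- second clause.
  obtain ⟨b, hb⟩ : ∃ b : ℝ≥0, {n | (a : ℝ≥0∞) ≤ 𝒜.mass n ∧ 𝒜.mass n < b}.Infinite := by
    by_contra hn
    push Not at hn
    exact h ⟨a, ha, hsum.lt_top, fun b => by simpa using hn b⟩
  by_cases hS : {n | 𝒜.mass n < a}.Infinite
  · have : Infinite {n // 𝒜.mass n < a} := hS.to_subtype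
    obtain ⟨e⟩ := nonempty_equiv_of_countable (α := ℕ) (β := {n // 𝒜.mass n < a})
    refine ⟨𝒜.restrict e, unit, doubling, 𝒜.isTypeZero_restrict e hsum, isTypeOne_unit,
      isTypeInfty_doubling, ?_⟩
    refine 𝒜.ell_isomorphic.trans ((WeightedSeq.isomorphic_split _
      fun n => 𝒜.mass n < a).trans ((𝒜.ell_restrict_isomorphic e).prodCongr
        (isomorphic_unit_prod_doubling ha (b := b) (fun i => ?_) ?_)))
    · rw [← not_lt, mass_toNNReal_lt_iff]
      exact i.2
    · have : Infinite {n | (a : ℝ≥0∞) ≤ 𝒜.mass n ∧ 𝒜.mass n < b} := hb.to_subtype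
      refine (Set.infinite_range_of_injective
        (f := fun n : {n | (a : ℝ≥0∞) ≤ 𝒜.mass n ∧ 𝒜.mass n < b} =>
          (⟨n, not_lt.2 n.2.1⟩ : {n // ¬ 𝒜.mass n < a}))
        (by rintro ⟨x, _⟩ ⟨y, _⟩ hxy; simpa using hxy)).mono ?_
      rintro _ ⟨n, rfl⟩
      exact 𝒜.mass_toNNReal_lt_iff.2 n.2.2
  · rw [Set.not_infinite] at hS
    -- With finitely many atoms below `a`, the least of their masses gives a positive lower bound
    -- for all masses.
    obtain ⟨c, hc, hca⟩ : ∃ c : ℝ≥0, 0 < c ∧ ∀ n, c ≤ (𝒜.mass n).toNNReal := by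
      rcases Set.eq_empty_or_nonempty {n | 𝒜.mass n < a} with h0 | h0
      · refine ⟨a, ha, fun n => not_lt.1 fun hn => ?_⟩
        have : n ∈ {n | 𝒜.mass n < a} := 𝒜.mass_toNNReal_lt_iff.1 hn
        rw [h0] at this
        exact this
      · obtain ⟨k, hk, hmin⟩ := Set.exists_min_image _ (fun n => (𝒜.mass n).toNNReal) hS h0
        refine ⟨min a (𝒜.mass k).toNNReal, lt_min ha (𝒜.mass_toNNReal_pos k), fun n => ?_⟩
        by_cases hn : 𝒜.mass n < a
        · exact (min_le_right _ _).trans (hmin n hn)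
        · refine (min_le_left _ _).trans ?_
          rwa [← not_lt, mass_toNNReal_lt_iff]
    refine ⟨halving, unit, doubling, isTypeZero_halving, isTypeOne_unit, isTypeInfty_doubling,
      𝒜.isomorphic_of_bounded_below hc hca (b := b) (hb.mono fun n hn => ?_)⟩
    exact 𝒜.mass_toNNReal_lt_iff.2 hn.2

/-- Under (E), for all `δ > 0` and `b < ∞` all but finitely many masses are below `δ` or at least
`b`. Hence the masses cannot accumulate at a value in `(0, ∞)`: neither at the upper limit of type
(iv) nor at the lower limit of type (v). -/
lemma isTypeVI_of_hasNoTypeOnePart (𝒜 : AtomicSpace.{u})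
    (h𝒜 : 𝒜.IsTypeIV ∨ 𝒜.IsTypeV ∨ 𝒜.IsTypeVI) (h : 𝒜.HasNoTypeOnePart) : 𝒜.IsTypeVI := by
  obtain ⟨a, ha, hsum, hfin⟩ := h
  have hlarge : ∀ b : ℝ≥0, ∀ᶠ n in atTop, (a : ℝ≥0∞) ≤ 𝒜.mass n → (b : ℝ≥0∞) ≤ 𝒜.mass n := by
    intro b
    rw [← Nat.cofinite_eq_atTop, eventually_cofinite]
    refine (hfin b).subset fun n hn => ?_
    simpa using hn
  have hsmall : ∀ δ : ℝ≥0∞, δ ≠ 0 → ∀ᶠ n in atTop, 𝒜.mass n < a → 𝒜.mass n < δ := by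
    intro δ hδ
    rw [← Nat.cofinite_eq_atTop, eventually_cofinite]
    refine ((ENNReal.finite_const_le_of_tsum_ne_top hsum.ne hδ).image Subtype.val).subset
      fun n hn => ?_
    simp only [Classical.not_imp, not_lt, Set.mem_ofPred_eq] at hn
    exact ⟨⟨n, hn.1⟩, hn.2, rfl⟩
  rcases h𝒜 with h | h | h
  · exfalso
    -- With `δ < limsup < b`, the masses are eventually below `b`, hence below `δ`, contradicting `δ
    -- < limsup`.
    obtain ⟨b, hb, hb'⟩ := ENNReal.lt_iff_exists_nnreal_btwn.1 h.2.2
    have hpos : 0 < limsup 𝒜.mass atTop := h.1 ▸ h.2.1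
    obtain ⟨δ, hδ, hδ'⟩ := exists_between hpos
    refine absurd hδ' (not_lt.2 (limsup_le_of_le (by isBoundedDefault) ?_))
    filter_upwards [eventually_lt_of_limsup_lt hb, hlarge b, hsmall δ hδ.ne'] with n h1 h2 h3
    by_cases hn : 𝒜.mass n < a
    · exact (h3 hn).le
    · exact absurd h1 (not_lt.2 (h2 (not_lt.1 hn)))
  · exfalso
    -- With `δ < liminf < b`, the masses are eventually above `δ`, hence at least `b`, contradicting
    -- `liminf < b`.
    obtain ⟨δ, hδ, hδ'⟩ := exists_between h.1
    obtain ⟨b, hb, hb'⟩ := ENNReal.lt_iff_exists_nnreal_btwn.1 h.2.1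
    refine absurd hb (not_lt.2 (le_liminf_of_le (by isBoundedDefault) ?_))
    filter_upwards [eventually_lt_of_lt_liminf hδ', hlarge b, hsmall δ hδ.ne'] with n h1 h2 h3
    by_cases hn : 𝒜.mass n < a
    · exact absurd h1 (not_lt.2 (h3 hn).le)
    · exact h2 (not_lt.1 hn)
  · exact h

/-- Lower limit zero and upper limit infinity make both sides of the cut at `a` infinite, so each
side is again a sequence of atoms. -/
theorem exists_isomorphic_of_hasNoTypeOnePart (𝒜 : AtomicSpace.{u}) (hVI : 𝒜.IsTypeVI)
    (h : 𝒜.HasNoTypeOnePart) :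
    ∃ X₁ X₃ : AtomicSpace.{0}, X₁.IsTypeZero ∧ X₃.IsTypeInfty ∧
      BanachIsomorphic (𝒜.ell p q) (X₁.ell p q × X₃.ell p q) := by
  obtain ⟨a, ha, hsum, hfin⟩ := h
  have ha' : (0 : ℝ≥0∞) < a := by exact_mod_cast ha
  have : Infinite {n // 𝒜.mass n < a} := by
    refine Set.Infinite.to_subtype (s := {n | 𝒜.mass n < a}) ?_
    rw [← Nat.frequently_atTop_iff_infinite]
    exact frequently_lt_of_liminf_lt (by isBoundedDefault) (hVI.1 ▸ ha')
  have : Infinite {n // ¬ 𝒜.mass n < a} := by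
    refine Set.Infinite.to_subtype (s := {n | ¬ 𝒜.mass n < a}) ?_
    rw [← Nat.frequently_atTop_iff_infinite]
    have hlt : (a : ℝ≥0∞) < limsup 𝒜.mass atTop := by
      rw [hVI.2.2]
      exact ENNReal.coe_lt_top
    exact (frequently_lt_of_lt_limsup (by isBoundedDefault) hlt).mono fun n hn => hn.not_gt
  obtain ⟨e⟩ := nonempty_equiv_of_countable (α := ℕ) (β := {n // 𝒜.mass n < a})
  obtain ⟨e'⟩ := nonempty_equiv_of_countable (α := ℕ) (β := {n // ¬ 𝒜.mass n < a})
  refine ⟨𝒜.restrict e, 𝒜.restrict e', 𝒜.isTypeZero_restrict e hsum.ne,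
    𝒜.isTypeInfty_restrict e' fun b => ?_, ?_⟩
  · simpa only [not_lt] using hfin b
  · exact 𝒜.ell_isomorphic.trans ((WeightedSeq.isomorphic_split _ fun n => 𝒜.mass n < a).trans
      ((𝒜.ell_restrict_isomorphic e).prodCongr (𝒜.ell_restrict_isomorphic e')))

end AtomicSpace

end

theorem mainTheorem12 (p q : ℝ) (hp : 1 < p) [Fact (1 ≤ q)] (hpq : p ≠ q)
    (𝒜 : AtomicSpace.{u}) (h𝒜 : 𝒜.IsTypeIV ∨ 𝒜.IsTypeV ∨ 𝒜.IsTypeVI) :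
    (¬ 𝒜.HasNoTypeOnePart →
      ∃ X₁ X₂ X₃ : AtomicSpace.{0}, X₁.IsTypeZero ∧ X₂.IsTypeOne ∧ X₃.IsTypeInfty ∧
        BanachIsomorphic (𝒜.ell p q) (X₁.ell p q × X₂.ell p q × X₃.ell p q)) ∧
    (𝒜.HasNoTypeOnePart →
      𝒜.IsTypeVI ∧
      ∃ X₁ X₃ : AtomicSpace.{0}, X₁.IsTypeZero ∧ X₃.IsTypeInfty ∧
        BanachIsomorphic (𝒜.ell p q) (X₁.ell p q × X₃.ell p q)) := by
  have : Fact (1 < p) := ⟨hp⟩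
  refine ⟨𝒜.exists_isomorphic_of_not_hasNoTypeOnePart, fun h => ?_⟩
  have hVI := 𝒜.isTypeVI_of_hasNoTypeOnePart h𝒜 h
  exact ⟨hVI, 𝒜.exists_isomorphic_of_hasNoTypeOnePart hVI h⟩
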